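/- For a complex finite-dimensional Lie algebra $\mathfrak g$, let $\chi[\mathfrak g]=\min_{f\in\mathfrak g^*}\dim\mathfrak g_f$ denote its index, where $\mathfrak g_f=\{x\in\mathfrak g:\ f([x,y])=0\ \text{for all } y\in\mathfrak g\}$. For $a=(a_1,\dots,a_k)\in\mathbb N^k$ with $n=a_1+\cdots+a_k$, let $\mathfrak p(a_1,\dots,a_k)\subseteq\mathfrak{gl}(n)=\mathfrak{gl}(n,\mathbb C)$ be the standard parabolic subalgebra of block upper triangular matrices with consecutive diagonal blocks of sizes $a_1,\dots,a_k$; zero entries of $a$ may be deleted without changing it, and $\mathfrak p$ of the empty sequence is the zero Lie algebra $\mathfrak{gl}(0)$. **Theorem.** Let $k\ge 1$ and $(a_1,\dots,a_k)\in\mathbb N^k$. Put $d_i=(a_1+\cdots+a_{i-1})-(a_{i+1}+\cdots+a_k)$ for $1\le i\le k-1$ and $d_k=-(a_1+\cdots+a_{k-1})$. Let $1\le i\le k$. 1. Suppose $d_i\ne 0$. For every $\alpha\in\mathbb Z$ such that $a_i+\alpha|d_i|\ge 0$, $$\chi[\mathfrak p(a_1,\dots,a_k)]=\chi[\mathfrak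 p(a_1,\dots,a_{i-1},\,a_i+\alpha|d_i|,\,a_{i+1},\dots,a_k)].$$ In particular, $$\chi[\mathfrak p(a_1,\dots,a_k)]=\chi[\mathfrak p(a_1,\dots,a_{i-1},\,r,\,a_{i+1},\dots,a_k)],$$ where $r$ is the remainder of the Euclidean division of $a_i$ by $|d_i|$. 2. Suppose $d_i=0$. Then $$\chi[\mathfrak p(a_1,\dots,a_k)]=a_i+\chi[\mathfrak p(a_1,\dots,a_{i-1},a_{i+1},\dots,a_k)].$$ -/

import Mathlib

namespace GlIndex

attribute [local instance 100] LieRing.ofAssociativeRing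

/-- The stabilizer `𝔤_f = {x ∈ 𝔤 | f ⁅x, y⁆ = 0 for all y ∈ 𝔤}` of a linear form `f` on the Lie
algebra `𝔤`, for the coadjoint action. -/
def stabilizer {K L : Type*} [Field K] [LieRing L] [LieAlgebra K L] (f : Module.Dual K L) :
    Submodule K L where
  carrier := {x | ∀ y : L, f ⁅x, y⁆ = 0}
  zero_mem' := by intro y; simp
  add_mem' := by
    intro x x' hx hx' y
    rw [add_lie, map_add, hx y, hx' y, add_zero]
  smul_mem' := by
    intro c x hx y
    rw [smul_lie, map_smul, hx y, smul_zero]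

/-- The index `χ[𝔤] = min {dim 𝔤_f | f ∈ 𝔤*}` of a finite-dimensional Lie algebra `𝔤`
(the infimum is over a nonempty set of natural numbers, hence is a minimum). -/
noncomputable def index (K L : Type*) [Field K] [LieRing L] [LieAlgebra K L] : ℕ :=
  sInf (Set.range fun f : Module.Dual K L => Module.finrank K (stabilizer f))

/-- The block containing a given row (or column) number when `{0, …, a₁ + ⋯ + aₖ - 1}` is cut
into consecutive intervals of lengths `a₁, …, aₖ`. -/
def block {k : ℕ} (a : Fin k → ℕ) (x : Fin (∑ j, a j)) : Fin k :=
  (finSigmaFinEquiv.symm x).1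

/-- The standard parabolic subalgebra `𝔭(a₁, …, aₖ)` of `𝔤𝔩(n)`, `n = a₁ + ⋯ + aₖ`: the block
upper triangular complex matrices with diagonal blocks of sizes `a₁, …, aₖ`. A zero entry of `a`
gives an empty block, so that it plays no role. -/
def parabolic {k : ℕ} (a : Fin k → ℕ) :
    LieSubalgebra ℂ (Matrix (Fin (∑ j, a j)) (Fin (∑ j, a j)) ℂ) where
  carrier := {M | M.BlockTriangular (block a)}
  zero_mem' := Matrix.blockTriangular_zero
  add_mem' := fun hM hN => hM.add hN
  smul_mem' := by
    intro c M hM x y hxy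
    rw [Matrix.smul_apply, hM hxy, smul_zero]
  lie_mem' := by
    intro M N hM hN
    rw [Ring.lie_def]
    exact (hM.mul hN).sub (hN.mul hM)

/-- The index `χ[𝔭(a₁, …, aₖ)]`. -/
noncomputable def chi {k : ℕ} (a : Fin k → ℕ) : ℕ :=
  index ℂ (parabolic a)

/-- The integers `dᵢ = (a₁ + ⋯ + aᵢ₋₁) - (aᵢ₊₁ + ⋯ + aₘ)` for `i < m`, and
`dₘ = -(a₁ + ⋯ + aₘ₋₁)`, attached to `(a₁, …, aₘ)` where `m = k + 1`. -/
def d {k : ℕ} (a : Fin (k + 1) → ℕ) (i : Fin (k + 1)) : ℤ :=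
  if i = Fin.last k then -∑ j ∈ Finset.Iio i, (a j : ℤ)
  else ∑ j ∈ Finset.Iio i, (a j : ℤ) - ∑ j ∈ Finset.Ioi i, (a j : ℤ)

end GlIndex

/-! Fix the block `i` and let its size m vary. Up to transposition, the blocks before it have total
size r + l and those after it r, so that l = |d_i|. The claim becomes: the index is periodic in m
with period l, and equals m plus a constant when l = 0.

The tool is a reduction along a two-sided ideal V of an associative algebra A (`index_eq_of_ideal`).
Suppose a form ξ on A restricts to a point of V* with open orbit. On any line through ξ, the forms
close to ξ can be conjugated to agree with ξ on V. The index of A is then that of a subalgebra B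
that fixes ξ|V and meets V only in 0, such that B + V contains the stabilizer of ξ|V. For matrices
supported on a preorder, with V an upper right corner and ξ the trace of a square block in it, this
identifies two sets of indices of equal size (`index_incidence_glue`).

A first gluing folds the r indices after block `i` onto r of the indices before it
(`blockIndex_eq_attachIndex`); block `i` is then related only to the set K of the l remaining
indices. A second gluing absorbs l indices of the block into K (`attachIndex_sum`), whence the
period l. If l = 0, the block splits off as a direct factor 𝔤𝔩(m), of index m (`index_matrix`). -/

namespace GlIndex

open Module Filter Topology Polynomial

attribute [local instance 100] LieRing.ofAssociativeRing

/-! ### Index and stabilizers under linear equivalences. -/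

section Generic

variable {K L L' : Type*} [Field K] [LieRing L] [LieAlgebra K L] [LieRing L'] [LieAlgebra K L']

theorem mem_stabilizer {f : Dual K L} {x : L} : x ∈ stabilizer f ↔ ∀ y, f ⁅x, y⁆ = 0 := Iff.rfl

theorem index_le (f : Dual K L) : index K L ≤ finrank K (stabilizer f) :=
  Nat.sInf_le ⟨f, rfl⟩

theorem exists_finrank_stabilizer_eq_index :
    ∃ f : Dual K L, finrank K (stabilizer f) = index K L :=
  Nat.sInf_mem (Set.range_nonempty fun f : Dual K L => finrank K (stabilizer f))

/-- A linear equivalence that respects the brackets up to a nonzero scalar identifies the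
stabilizers. -/
theorem finrank_stabilizer_comp (e : L ≃ₗ[K] L') (c : K) (hc : c ≠ 0)
    (he : ∀ x y, e ⁅x, y⁆ = c • ⁅e x, e y⁆) (f : Dual K L') :
    finrank K (stabilizer (f ∘ₗ (e : L →ₗ[K] L'))) = finrank K (stabilizer f) := by
  have : stabilizer (f ∘ₗ (e : L →ₗ[K] L')) = (stabilizer f).comap (e : L →ₗ[K] L') := by
    ext x
    simp only [mem_stabilizer, Submodule.mem_comap, LinearMap.comp_apply, LinearEquiv.coe_coe, he,
      map_smul, smul_eq_mul, mul_eq_zero, hc, false_or]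
    exact ⟨fun h y => by simpa using h (e.symm y), fun h y => h _⟩
  rw [this]
  exact LinearEquiv.finrank_eq (e.ofSubmodule' (stabilizer f))

/-- The scalar makes room for transposition of matrices, which negates the bracket (c = -1). -/
theorem index_congr (e : L ≃ₗ[K] L') (c : K) (hc : c ≠ 0)
    (he : ∀ x y, e ⁅x, y⁆ = c • ⁅e x, e y⁆) : index K L = index K L' := by
  apply le_antisymm
  · obtain ⟨f, hf⟩ := exists_finrank_stabilizer_eq_index (K := K) (L := L')
    rw [← hf, ← finrank_stabilizer_comp e c hc he f]
    exact index_le _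
  · obtain ⟨f, hf⟩ := exists_finrank_stabilizer_eq_index (K := K) (L := L)
    have := finrank_stabilizer_comp e c hc he (f ∘ₗ (e.symm : L' →ₗ[K] L))
    have h2 : (f ∘ₗ (e.symm : L' →ₗ[K] L)) ∘ₗ (e : L →ₗ[K] L') = f := by ext; simp
    rw [h2] at this
    rw [← hf, this]
    exact index_le _

end Generic

/-! ### Semicontinuity of the stabilizer dimension along a line. -/

/-- The kernel of a pencil of linear maps is generically at most as large as at one point. -/
theorem finrank_ker_pencil_le {E F : Type*} [AddCommGroup E] [Module ℂ E] [FiniteDimensional ℂ E]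
    [AddCommGroup F] [Module ℂ F] (M N : E →ₗ[ℂ] F) :
    ∀ᶠ t : ℂ in cofinite,
      finrank ℂ (LinearMap.ker (M + t • N)) ≤ finrank ℂ (LinearMap.ker (M + N)) := by
  -- With `G` a left inverse of `M + N` on a complement `C` of its kernel, the determinant of `G (M
  -- + t N)` on `C` is a polynomial in t with value 1 at t = 1. Where it does not vanish, the kernel
  -- of `M + t N` meets `C` trivially.
  obtain ⟨C, hC⟩ := (LinearMap.ker (M + N)).exists_isCompl
  have hinj : LinearMap.ker ((M + N) ∘ₗ C.subtype) = ⊥ := by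
    rw [LinearMap.ker_comp, ← Submodule.disjoint_iff_comap_eq_bot]
    exact hC.disjoint.symm
  obtain ⟨G, hG⟩ := LinearMap.exists_leftInverse_of_injective _ hinj
  let b := finBasis ℂ C
  let A₀ := LinearMap.toMatrix b b (G ∘ₗ M ∘ₗ C.subtype)
  let A₁ := LinearMap.toMatrix b b (G ∘ₗ N ∘ₗ C.subtype)
  let p : ℂ[X] := (A₀.map Polynomial.C + (X : ℂ[X]) • A₁.map Polynomial.C).det
  have hp : ∀ t, p.eval t = LinearMap.det (G ∘ₗ (M + t • N) ∘ₗ C.subtype) := by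
    intro t
    rw [← LinearMap.det_toMatrix b, ← Polynomial.coe_evalRingHom, RingHom.map_det]
    congr 1
    ext i j
    simp [A₀, A₁, LinearMap.toMatrix_apply, mul_comm t]
  have hp0 : p ≠ 0 := by
    intro h
    have h1 := hp 1
    rw [one_smul, hG, LinearMap.det_id, h] at h1
    simp at h1
  have hfin : ∀ᶠ t : ℂ in cofinite, p.eval t ≠ 0 := by
    have := Polynomial.finite_setOfPred_isRoot hp0
    simpa [eventually_cofinite, Polynomial.IsRoot] using this
  filter_upwards [hfin] with t ht
  rw [hp] at ht
  have hker : LinearMap.ker (M + t • N) ⊓ C = ⊥ := by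
    rw [Submodule.eq_bot_iff]
    rintro x ⟨hx, hxC⟩
    have := LinearMap.ker_eq_bot.2 (show Function.Injective (G ∘ₗ (M + t • N) ∘ₗ C.subtype) from
      (LinearMap.equivOfDetNeZero _ ht).injective)
    have h2 : (⟨x, hxC⟩ : C) ∈ LinearMap.ker (G ∘ₗ (M + t • N) ∘ₗ C.subtype) := by
      have hx' : (M + t • N) x = 0 := hx
      rw [LinearMap.mem_ker, LinearMap.comp_apply, LinearMap.comp_apply, C.subtype_apply, hx',
        map_zero]
    rw [this, Submodule.mem_bot] at h2
    simpa using congrArg Subtype.val h2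
  have h1 := Submodule.finrank_sup_add_finrank_inf_eq (LinearMap.ker (M + t • N)) C
  rw [hker, finrank_bot] at h1
  have h2 := Submodule.finrank_add_eq_of_isCompl hC
  have h3 := Submodule.finrank_le (LinearMap.ker (M + t • N) ⊔ C)
  omega

theorem finrank_stabilizer_pencil_le {L : Type*} [LieRing L] [LieAlgebra ℂ L]
    [FiniteDimensional ℂ L] (f g : Dual ℂ L) :
    ∀ᶠ t : ℂ in cofinite,
      finrank ℂ (stabilizer (f + t • g)) ≤ finrank ℂ (stabilizer (f + g)) := by
  let B : Dual ℂ L → (L →ₗ[ℂ] Dual ℂ L) := fun f =>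
    LinearMap.mk₂ ℂ (fun x y => f ⁅x, y⁆) (by simp) (by simp) (by simp) (by simp)
  have hB : ∀ f, stabilizer f = LinearMap.ker (B f) := by
    intro f
    ext x
    simp [mem_stabilizer, LinearMap.ext_iff, B]
  filter_upwards [finrank_ker_pencil_le (B f) (B g)] with t ht
  rw [hB, hB]
  have h1 : B (f + t • g) = B f + t • B g := by ext; simp [B]
  have h2 : B (f + g) = B f + B g := by ext; simp [B]
  rwa [h1, h2]

/-! ### Reduction of the index along an ideal of an associative algebra. -/

section Associative

variable {A : Type*} [Ring A] [Algebra ℂ A]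

/-- Makes invertibility an open condition, detected by a determinant. -/
theorem isUnit_of_det_leftMulMatrix_ne_zero {ι : Type*} [Fintype ι] [DecidableEq ι]
    (b : Basis ι ℂ A) {u : A} (hu : (Algebra.leftMulMatrix b u).det ≠ 0) : IsUnit u := by
  have hu' : IsUnit (Algebra.leftMulMatrix b u).det := isUnit_iff_ne_zero.2 hu
  have hinj : ∀ x y, u * x = u * y → x = y := by
    intro x y h
    apply b.repr.injective
    ext1 i
    have h' : (Algebra.leftMulMatrix b u).mulVec (b.repr x)
        = (Algebra.leftMulMatrix b u).mulVec (b.repr y) := by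
      rw [Algebra.leftMulMatrix_mulVec_repr, Algebra.leftMulMatrix_mulVec_repr, h]
    have := congrArg ((Algebra.leftMulMatrix b u)⁻¹.mulVec) h'
    rw [Matrix.mulVec_mulVec, Matrix.mulVec_mulVec, Matrix.nonsing_inv_mul _ hu',
      Matrix.one_mulVec, Matrix.one_mulVec] at this
    exact congrFun this i
  have hright : ∃ w, u * w = 1 := by
    refine ⟨b.equivFun.symm ((Algebra.leftMulMatrix b u)⁻¹.mulVec (b.repr 1)), ?_⟩
    apply b.equivFun.injective
    rw [Basis.equivFun_apply, Basis.equivFun_apply, ← Algebra.leftMulMatrix_mulVec_repr,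
      ← Basis.equivFun_apply, LinearEquiv.apply_symm_apply, Matrix.mulVec_mulVec,
      Matrix.mul_nonsing_inv _ hu', Matrix.one_mulVec]
  obtain ⟨w, hw⟩ := hright
  have hw' : w * u = 1 := hinj _ _ (by rw [← mul_assoc, hw, one_mul, mul_one])
  exact ⟨⟨u, w, hw, hw'⟩, rfl⟩

theorem finrank_stabilizer_conj (u : Aˣ) (f g : Dual ℂ A)
    (h : ∀ x, g x = f (u * x * ↑u⁻¹)) :
    finrank ℂ (stabilizer g) = finrank ℂ (stabilizer f) := by
  let e : A ≃ₗ[ℂ] A :=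
    { toFun := fun x => u * x * ↑u⁻¹
      invFun := fun x => ↑u⁻¹ * x * u
      map_add' := fun x y => by rw [mul_add, add_mul]
      map_smul' := fun c x => by simp
      left_inv := fun x => by simp [mul_assoc]
      right_inv := fun x => by simp [mul_assoc] }
  have hg : g = f ∘ₗ (e : A →ₗ[ℂ] A) := by ext x; exact h x
  rw [hg]
  apply finrank_stabilizer_comp e 1 one_ne_zero
  intro x y
  simp [e, Ring.lie_def, mul_sub, sub_mul, mul_assoc]

variable [FiniteDimensional ℂ A]

/-- If the orbit map of the restriction of `f` to the ideal `V` is infinitesimally surjective, then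
forms close to `f` on a line can be conjugated so as to agree with `f` on `V`. -/
theorem eventually_exists_conj_eq (V : Submodule ℂ A) (hVr : ∀ v ∈ V, ∀ x, v * x ∈ V)
    (f g : Dual ℂ A) (hf : ∀ η : Dual ℂ V, ∃ x : A, ∀ v : V, f (x * v - v * x) = η v) :
    ∀ᶠ t : ℂ in 𝓝 0, ∃ u : Aˣ, ∀ v ∈ V, (f + t • g) (u * v * ↑u⁻¹) = f v := by
  -- After replacing v by v u, the equation (f + t g)(u v u⁻¹) = f(v) becomes (f + t g)(u v) = f(v
  -- u), that is `T u + t • P u = 0`, which is linear in u.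
  let T : A →ₗ[ℂ] Dual ℂ V :=
    LinearMap.mk₂ ℂ (fun x (v : V) => f (x * v - v * x))
      (by intros; simp [add_mul, mul_add]; ring) (by intros; simp [mul_sub])
      (by intros; simp [add_mul, mul_add]; ring) (by intros; simp [mul_sub])
  let P : A →ₗ[ℂ] Dual ℂ V :=
    LinearMap.mk₂ ℂ (fun x (v : V) => g (x * v))
      (by intros; simp [add_mul]) (by intros; simp)
      (by intros; simp [mul_add]) (by intros; simp)
  have hT : ∀ x (v : V), T x v = f (x * v - v * x) := fun _ _ => rfl
  have hP : ∀ x (v : V), P x v = g (x * v) := fun _ _ => rfl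
  have hTs : LinearMap.range T = ⊤ := by
    rw [LinearMap.range_eq_top]
    intro η
    obtain ⟨x, hx⟩ := hf η
    exact ⟨x, LinearMap.ext hx⟩
  obtain ⟨S, hS⟩ := LinearMap.exists_rightInverse_of_surjective T hTs
  have hS' : ∀ η, T (S η) = η := fun η => LinearMap.congr_fun hS η
  let b := finBasis ℂ (Dual ℂ V)
  let q := finBasis ℂ A
  let E := LinearMap.toMatrix b b (P ∘ₗ S)
  -- Seeking u = 1 - S w, with S a section of T, leads to (1 + t P S) w = t P(1). Cramer's rule,
  -- with the determinant cleared, gives a solution polynomial in t with `u 0 = 1`, hence invertible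
  -- for small t.
  let N : ℂ → Matrix _ _ ℂ := fun t => 1 + t • E
  let c : ℂ → _ := fun t => (N t).adjugate.mulVec (t • b.equivFun (P 1))
  let u : ℂ → A := fun t => (N t).det • 1 - ∑ i, c t i • S (b i)
  have hNc : Continuous N := by fun_prop
  have hcc : Continuous c := by
    apply Continuous.matrix_mulVec hNc.matrix_adjugate
    fun_prop
  have hLu : ∀ t, Algebra.leftMulMatrix q (u t) =
      (N t).det • 1 - ∑ i, c t i • Algebra.leftMulMatrix q (S (b i)) := by
    intro t
    simp [u, map_sub, map_sum, map_smul]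
  have hdet : Continuous fun t => (Algebra.leftMulMatrix q (u t)).det := by
    simp only [hLu]
    apply Continuous.matrix_det
    have := hNc.matrix_det
    fun_prop
  have hu0 : u 0 = 1 := by simp [u, N, c]
  have hev : ∀ᶠ t in 𝓝 (0 : ℂ), (Algebra.leftMulMatrix q (u t)).det ≠ 0 := by
    apply hdet.continuousAt.eventually_ne
    simp [hu0]
  have hkey : ∀ t, T (u t) + t • P (u t) = 0 := by
    intro t
    have hT1 : T 1 = 0 := by ext v; simp [hT]
    have hsum : ∑ i, c t i • (b i + t • P (S (b i))) = (t * (N t).det) • P 1 := by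
      apply b.equivFun.injective
      have h1 : ∀ i, b.equivFun (b i + t • P (S (b i))) = (N t).col i := by
        intro i
        ext j
        have h0 : b.equivFun (P (S (b i))) j = E j i := by
          simp only [E, LinearMap.toMatrix_apply, LinearMap.comp_apply, Basis.equivFun_apply]
        have hN : N t j i = (if j = i then 1 else 0) + t * E j i := by
          simp only [N, Matrix.add_apply, Matrix.smul_apply, Matrix.one_apply, smul_eq_mul]
        rw [map_add, map_smul, Pi.add_apply, Pi.smul_apply, h0, Basis.equivFun_self,
          Matrix.col_apply, hN, smul_eq_mul]
        simp only [eq_comm]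
      have h2 : b.equivFun (∑ i, c t i • (b i + t • P (S (b i)))) = (N t).mulVec (c t) := by
        rw [map_sum]
        simp only [map_smul, h1]
        ext j
        simp only [Finset.sum_apply, Pi.smul_apply, Matrix.col_apply, smul_eq_mul, Matrix.mulVec,
          dotProduct]
        exact Finset.sum_congr rfl fun i _ => mul_comm _ _
      rw [h2]
      simp only [c]
      rw [Matrix.mulVec_mulVec, Matrix.mul_adjugate, Matrix.smul_mulVec, Matrix.one_mulVec,
        map_smul, smul_smul, mul_comm]
    have h3 : ∑ i, c t i • b i + t • ∑ i, c t i • P (S (b i)) = (t * (N t).det) • P 1 := by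
      rw [← hsum, Finset.smul_sum, ← Finset.sum_add_distrib]
      refine Finset.sum_congr rfl fun i _ => ?_
      rw [smul_add, smul_comm]
    simp only [u, map_sub, map_smul, map_sum, hT1, hS', smul_zero, zero_sub, smul_sub]
    rw [mul_smul] at h3
    rw [← h3]
    abel
  filter_upwards [hev] with t ht
  obtain ⟨w, hw⟩ := isUnit_of_det_leftMulMatrix_ne_zero q ht
  refine ⟨w, fun v hv => ?_⟩
  have h4 := LinearMap.congr_fun (hkey t) ⟨v * ↑w⁻¹, hVr v hv _⟩
  simp only [LinearMap.add_apply, LinearMap.smul_apply, hT, hP, ← hw, LinearMap.zero_apply,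
    map_sub, mul_assoc, Units.inv_mul, mul_one, smul_eq_mul] at h4
  simp only [LinearMap.add_apply, LinearMap.smul_apply, mul_assoc, smul_eq_mul]
  linear_combination h4

variable {B : Type*} [Ring B] [Algebra ℂ B]

/-- The stabilizer of a form whose restriction to an ideal `V` lies in the open orbit. -/
theorem finrank_stabilizer_eq_of_isCompl (V : Submodule ℂ A) (f : Dual ℂ A)
    (hf : ∀ η : Dual ℂ V, ∃ x : A, ∀ v : V, f (x * v - v * x) = η v)
    (φ : B →ₐ[ℂ] A) (hφ : Function.Injective φ)
    (hdisj : ∀ x, φ x ∈ V → φ x = 0)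
    (hφV : ∀ x, ∀ v ∈ V, f (φ x * v - v * φ x) = 0)
    (hmem : ∀ a : A, (∀ v ∈ V, f (a * v - v * a) = 0) → ∃ x, ∃ v ∈ V, a = φ x + v) :
    finrank ℂ (stabilizer f) = finrank ℂ (stabilizer (f ∘ₗ φ.toLinearMap)) := by
  let T : A →ₗ[ℂ] Dual ℂ V :=
    LinearMap.mk₂ ℂ (fun x (v : V) => f (x * v - v * x))
      (by intros; simp [add_mul, mul_add]; ring) (by intros; simp [mul_sub])
      (by intros; simp [add_mul, mul_add]; ring) (by intros; simp [mul_sub])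
  have hT : ∀ x (v : V), T x v = f (x * v - v * x) := fun _ _ => rfl
  -- Every form on V is f([x, ·]) for some x, so an element of V that stabilizes f is killed by all
  -- of V*.
  have hV0 : ∀ v ∈ V, (∀ y, f ⁅v, y⁆ = 0) → v = 0 := by
    intro v hv h
    have h1 : (⟨v, hv⟩ : V) = 0 := by
      rw [← Module.forall_dual_apply_eq_zero_iff ℂ]
      intro η
      obtain ⟨x, hx⟩ := hf η
      rw [← hx, ← neg_sub, map_neg, neg_eq_zero, ← Ring.lie_def]
      exact h x
    simpa using congrArg Subtype.val h1
  -- The form f([φ x, ·]) vanishes on ker T, so it lies in the range of the transpose of T. By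
  -- biduality it is therefore f([·, v]) for some v in V.
  have hcorr : ∀ x ∈ stabilizer (f ∘ₗ φ.toLinearMap), ∃ v ∈ V, φ x + v ∈ stabilizer f := by
    intro x hx
    let ψ : Dual ℂ A := f ∘ₗ (LinearMap.mulLeft ℂ (φ x) - LinearMap.mulRight ℂ (φ x))
    have hψ : ∀ y, ψ y = f (φ x * y - y * φ x) := fun y => by simp [ψ]
    have hmemψ : ψ ∈ (LinearMap.ker T).dualAnnihilator := by
      rw [Submodule.mem_dualAnnihilator]
      intro y hy
      obtain ⟨z, v, hv, rfl⟩ := hmem y fun v hv => LinearMap.congr_fun hy ⟨v, hv⟩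
      have h1 := hx z
      simp only [Ring.lie_def, LinearMap.comp_apply, AlgHom.toLinearMap_apply, map_sub,
        map_mul] at h1
      have h2 := hφV x v hv
      rw [hψ]
      simp only [mul_add, add_mul, map_sub, map_add] at h1 h2 ⊢
      linear_combination h1 + h2
    rw [← LinearMap.range_dualMap_eq_dualAnnihilator_ker] at hmemψ
    obtain ⟨θ, hθ⟩ := hmemψ
    obtain ⟨v, hv⟩ := (Module.evalEquiv ℂ V).surjective θ
    refine ⟨v, v.2, fun y => ?_⟩
    have h1 : ψ y = f (y * v - v * y) := by
      rw [← hθ, ← hv, ← hT]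
      simp
    rw [hψ] at h1
    simp only [Ring.lie_def, mul_add, add_mul, map_sub, map_add] at h1 ⊢
    linear_combination h1
  have hsplit : ∀ a ∈ stabilizer f, ∃ x ∈ stabilizer (f ∘ₗ φ.toLinearMap), ∃ v ∈ V,
      a = φ x + v := by
    intro a ha
    obtain ⟨x, v, hv, rfl⟩ := hmem a fun v _ => by rw [← Ring.lie_def]; exact ha v
    refine ⟨x, fun y => ?_, v, hv, rfl⟩
    have h1 := ha (φ y)
    have h2 := hφV y v hv
    simp only [Ring.lie_def, LinearMap.comp_apply, AlgHom.toLinearMap_apply, map_sub,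
      map_mul, mul_add, add_mul, map_add] at h1 h2 ⊢
    linear_combination h1 + h2
  have hφker : LinearMap.ker φ.toLinearMap = ⊥ := LinearMap.ker_eq_bot.2 hφ
  have hdisj' : Disjoint ((stabilizer (f ∘ₗ φ.toLinearMap)).map φ.toLinearMap) V := by
    rw [Submodule.disjoint_def]
    rintro _ ⟨x, -, rfl⟩ hx
    exact hdisj x hx
  have hdisj2 : Disjoint (stabilizer f) V := by
    rw [Submodule.disjoint_def]
    exact fun v hv hvV => hV0 v hvV hv
  -- Both stabilizers are complements of V in the same space, hence have equal dimension.
  have hsup : stabilizer f ⊔ V = (stabilizer (f ∘ₗ φ.toLinearMap)).map φ.toLinearMap ⊔ V := by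
    apply le_antisymm
    · refine sup_le (fun a ha => ?_) le_sup_right
      obtain ⟨x, hx, v, hv, rfl⟩ := hsplit a ha
      exact Submodule.add_mem_sup (Submodule.mem_map_of_mem hx) hv
    · refine sup_le ?_ le_sup_right
      rintro _ ⟨x, hx, rfl⟩
      obtain ⟨v, hv, h⟩ := hcorr x hx
      have := Submodule.add_mem_sup h (V.neg_mem hv)
      simpa using this
  have h1 := Submodule.finrank_sup_add_finrank_inf_eq (stabilizer f) V
  have h2 := Submodule.finrank_sup_add_finrank_inf_eq
    ((stabilizer (f ∘ₗ φ.toLinearMap)).map φ.toLinearMap) V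
  rw [hdisj2.eq_bot, finrank_bot] at h1
  rw [hdisj'.eq_bot, finrank_bot] at h2
  have h3 := LinearEquiv.finrank_eq
    (Submodule.equivMapOfInjective φ.toLinearMap hφ (stabilizer (f ∘ₗ φ.toLinearMap)))
  rw [hsup] at h1
  omega

/-- Reduction of the index along a two-sided ideal whose dual has an open orbit. -/
theorem index_eq_of_ideal (V : Submodule ℂ A) (hVl : ∀ v ∈ V, ∀ x, x * v ∈ V)
    (hVr : ∀ v ∈ V, ∀ x, v * x ∈ V) (ξ : Dual ℂ A)
    (hξ : ∀ η : Dual ℂ V, ∃ x : A, ∀ v : V, ξ (x * v - v * x) = η v)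
    (φ : B →ₐ[ℂ] A) (hφ : Function.Injective φ)
    (hdisj : ∀ x, φ x ∈ V → φ x = 0)
    (hφV : ∀ x, ∀ v ∈ V, ξ (φ x * v - v * φ x) = 0)
    (hmem : ∀ a : A, (∀ v ∈ V, ξ (a * v - v * a) = 0) → ∃ x, ∃ v ∈ V, a = φ x + v) :
    index ℂ A = index ℂ B := by
  have hbr : ∀ x, ∀ v ∈ V, x * v - v * x ∈ V := fun x v hv =>
    V.sub_mem (hVl v hv x) (hVr v hv x)
  have hred : ∀ f : Dual ℂ A, (∀ v ∈ V, f v = ξ v) →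
      finrank ℂ (stabilizer f) = finrank ℂ (stabilizer (f ∘ₗ φ.toLinearMap)) := by
    intro f hf
    apply finrank_stabilizer_eq_of_isCompl V f _ φ hφ hdisj
    · intro x v hv
      rw [hf _ (hbr _ _ hv)]
      exact hφV x v hv
    · intro a ha
      refine hmem a fun v hv => ?_
      rw [← hf _ (hbr _ _ hv)]
      exact ha v hv
    · intro η
      obtain ⟨x, hx⟩ := hξ η
      refine ⟨x, fun v => ?_⟩
      rw [hf _ (hbr _ _ v.2)]
      exact hx v
  apply le_antisymm
  · obtain ⟨g, hg⟩ := exists_finrank_stabilizer_eq_index (K := ℂ) (L := B)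
    -- The sum of φ(B) and V is direct, so an optimal form on B extends to a form on A that equals ξ
    -- on V.
    obtain ⟨ψ, hψ⟩ := LinearMap.exists_leftInverse_of_injective
      (((LinearMap.range φ.toLinearMap).subtype).coprod V.subtype) (by
        rw [LinearMap.ker_eq_bot']
        rintro ⟨⟨_, x, rfl⟩, v⟩ h
        simp only [LinearMap.coprod_apply, Submodule.subtype_apply,
          AlgHom.toLinearMap_apply] at h
        have h1 : φ x = -v := eq_neg_of_add_eq_zero_left h
        have h2 : φ x = 0 := hdisj x (h1 ▸ V.neg_mem v.2)
        have h3 : (v : A) = 0 := by simpa [h2] using h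
        ext
        · simpa using h2
        · simpa using h3)
    let e := LinearEquiv.ofInjective φ.toLinearMap hφ
    let f : Dual ℂ A := ((g ∘ₗ (e.symm : _ →ₗ[ℂ] B)).coprod (ξ ∘ₗ V.subtype)) ∘ₗ ψ
    have hf1 : ∀ v ∈ V, f v = ξ v := by
      intro v hv
      have := LinearMap.congr_fun hψ (0, ⟨v, hv⟩)
      simp only [LinearMap.comp_apply, LinearMap.coprod_apply, Submodule.subtype_apply, map_zero,
        zero_add, LinearMap.id_apply] at this
      simp [f, this]
    have hf2 : f ∘ₗ φ.toLinearMap = g := by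
      ext x
      have := LinearMap.congr_fun hψ (e x, 0)
      simp only [LinearMap.comp_apply, LinearMap.coprod_apply, Submodule.subtype_apply, map_zero,
        add_zero, LinearMap.id_apply] at this
      have he : ((e x : LinearMap.range φ.toLinearMap) : A) = φ x := rfl
      rw [he] at this
      simp [f, this]
    rw [← hg, ← hf2, ← hred f hf1]
    exact index_le f
  -- Let g be optimal on A and move along the line from ξ (t = 0) to g (t = 1). For small nonzero t
  -- the stabilizer is no larger than that of g, and a conjugate of the form agrees with ξ on V.
  · obtain ⟨g, hg⟩ := exists_finrank_stabilizer_eq_index (K := ℂ) (L := A)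
    have h1 := (finrank_stabilizer_pencil_le ξ (g - ξ)).filter_mono (nhdsNE_le_cofinite 0)
    have h2 := (eventually_exists_conj_eq V hVr ξ (g - ξ) hξ).filter_mono
      (nhdsWithin_le_nhds (s := {0}ᶜ))
    obtain ⟨t, ht1, u, hu⟩ := (h1.and h2).exists
    rw [add_sub_cancel, hg] at ht1
    let f : Dual ℂ A := (ξ + t • (g - ξ)) ∘ₗ
      (LinearMap.mulRight ℂ (↑u⁻¹ : A) ∘ₗ LinearMap.mulLeft ℂ (u : A))
    have hf : ∀ x, f x = (ξ + t • (g - ξ)) (u * x * ↑u⁻¹) := fun x => by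
      simp only [f, LinearMap.comp_apply, LinearMap.mulLeft_apply, LinearMap.mulRight_apply]
    have h3 := finrank_stabilizer_conj u (ξ + t • (g - ξ)) f hf
    rw [← h3, hred f fun v hv => by rw [hf, hu v hv]] at ht1
    exact (index_le _).trans ht1

end Associative

theorem index_prod (A B : Type*) [Ring A] [Algebra ℂ A] [FiniteDimensional ℂ A] [Ring B]
    [Algebra ℂ B] [FiniteDimensional ℂ B] : index ℂ (A × B) = index ℂ A + index ℂ B := by
  have key : ∀ (f : Dual ℂ A) (g : Dual ℂ B), finrank ℂ (stabilizer (f.coprod g)) =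
      finrank ℂ (stabilizer f) + finrank ℂ (stabilizer g) := by
    intro f g
    have h : stabilizer (f.coprod g) = (stabilizer f).prod (stabilizer g) := by
      ext ⟨x, y⟩
      simp only [mem_stabilizer, Submodule.mem_prod, Ring.lie_def, LinearMap.coprod_apply,
        Prod.fst_sub, Prod.snd_sub, Prod.fst_mul, Prod.snd_mul]
      constructor
      · intro h
        exact ⟨fun z => by simpa using h (z, 0), fun z => by simpa using h (0, z)⟩
      · rintro ⟨h1, h2⟩ ⟨z, w⟩
        simp [h1, h2]
    let e : (stabilizer f).prod (stabilizer g) ≃ₗ[ℂ] stabilizer f × stabilizer g :=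
      { toFun := fun p => (⟨p.1.1, p.2.1⟩, ⟨p.1.2, p.2.2⟩)
        invFun := fun p => ⟨(p.1.1, p.2.1), p.1.2, p.2.2⟩
        map_add' := fun _ _ => rfl
        map_smul' := fun _ _ => rfl
        left_inv := fun _ => rfl
        right_inv := fun _ => rfl }
    rw [h, LinearEquiv.finrank_eq e, finrank_prod]
  apply le_antisymm
  · obtain ⟨f, hf⟩ := exists_finrank_stabilizer_eq_index (K := ℂ) (L := A)
    obtain ⟨g, hg⟩ := exists_finrank_stabilizer_eq_index (K := ℂ) (L := B)
    rw [← hf, ← hg, ← key]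
    exact index_le _
  · obtain ⟨h, hh⟩ := exists_finrank_stabilizer_eq_index (K := ℂ) (L := A × B)
    rw [← hh, ← LinearMap.coprod_comp_inl_inr h, key]
    exact add_le_add (index_le _) (index_le _)

/-! ### The index of 𝔤𝔩(m). -/

/-- The form `x ↦ tr (F x)`. -/
def traceForm {n : Type*} [Fintype n] (F : Matrix n n ℂ) : Dual ℂ (Matrix n n ℂ) :=
  Matrix.traceLinearMap n ℂ ℂ ∘ₗ LinearMap.mulLeft ℂ F

theorem traceForm_apply {n : Type*} [Fintype n] (F x : Matrix n n ℂ) :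
    traceForm F x = (F * x).trace := rfl

theorem exists_eq_traceForm {n : Type*} [Fintype n] [DecidableEq n]
    (f : Dual ℂ (Matrix n n ℂ)) : ∃ F, f = traceForm F := by
  refine ⟨Matrix.of fun j i => f (Matrix.single i j 1), ?_⟩
  apply Matrix.ext_linearMap
  intro i j
  ext
  simp [traceForm_apply, Matrix.trace_mul_single]

theorem pow_mem_stabilizer_traceForm {n : Type*} [Fintype n] [DecidableEq n]
    (F : Matrix n n ℂ) (i : ℕ) : F ^ i ∈ stabilizer (traceForm F) := by
  intro y
  rw [traceForm_apply, Ring.lie_def, mul_sub, Matrix.trace_sub, sub_eq_zero, ← mul_assoc,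
    ← mul_assoc, Matrix.trace_mul_comm (F * y), ← mul_assoc, ← pow_succ, ← pow_succ']

theorem index_matrix (m : ℕ) : index ℂ (Matrix (Fin m) (Fin m) ℂ) = m := by
  -- Distinct diagonal entries: the stabilizer of the trace form of `D` consists of diagonal
  -- matrices.
  let D : Matrix (Fin m) (Fin m) ℂ := Matrix.diagonal fun i => (i : ℂ)
  have hinj : Function.Injective fun i : Fin m => ((i : ℕ) : ℂ) := fun i j h =>
    Fin.ext (Nat.cast_injective h)
  apply le_antisymm
  · refine (index_le (traceForm D)).trans ?_
    have hle : stabilizer (traceForm D) ≤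
        LinearMap.range (Matrix.diagonalLinearMap (Fin m) ℂ ℂ) := by
      intro x hx
      refine ⟨x.diag, ?_⟩
      ext i j
      by_cases hij : i = j
      · subst hij; simp
      · have h1 := hx (Matrix.single j i 1)
        rw [traceForm_apply, Ring.lie_def, mul_sub, Matrix.trace_sub, ← mul_assoc, ← mul_assoc,
          Matrix.trace_mul_single, Matrix.trace_mul_comm, ← mul_assoc,
          Matrix.trace_mul_single] at h1
        simp only [D, Matrix.diagonal_mul, Matrix.mul_diagonal] at h1
        have h2 : ((i : ℕ) : ℂ) - ((j : ℕ) : ℂ) ≠ 0 := sub_ne_zero.2 fun h => hij (hinj h)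
        have h3 : x i j = 0 := by
          have : (((i : ℕ) : ℂ) - ((j : ℕ) : ℂ)) * x i j = 0 := by
            simp at h1
            linear_combination h1
          exact (mul_eq_zero.1 this).resolve_left h2
        simp [Matrix.diagonal_apply_ne _ hij, h3]
    refine (Submodule.finrank_mono hle).trans ((LinearMap.finrank_range_le _).trans ?_)
    simp
  · obtain ⟨g, hg⟩ := exists_finrank_stabilizer_eq_index (K := ℂ) (L := Matrix (Fin m) (Fin m) ℂ)
    obtain ⟨G, rfl⟩ := exists_eq_traceForm g
    let F : ℂ → Matrix (Fin m) (Fin m) ℂ := fun t => D + t • (G - D)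
    have hF : ∀ t, traceForm (F t) = traceForm D + t • (traceForm G - traceForm D) := by
      intro t
      ext1 x
      simp [F, traceForm_apply, add_mul, sub_mul, Matrix.trace_add, Matrix.trace_sub]
    -- Row i holds the diagonal of `F t ^ i`. At t = 0 this is a transposed Vandermonde matrix, so
    -- for small t the powers of `F t` are m independent elements of the stabilizer.
    let W : ℂ → Matrix (Fin m) (Fin m) ℂ := fun t => Matrix.of fun i j => (F t ^ (i : ℕ)) j j
    have hFc : Continuous F := by fun_prop
    have hWc : Continuous W := by
      refine continuous_matrix fun i j => ?_
      exact (hFc.pow (i : ℕ)).matrix_elem j j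
    have hW0 : (W 0).det ≠ 0 := by
      have : W 0 = (Matrix.vandermonde fun i : Fin m => ((i : ℕ) : ℂ)).transpose := by
        ext i j
        simp [W, F, D, Matrix.vandermonde_apply, Matrix.diagonal_pow]
      rw [this, Matrix.det_transpose]
      exact Matrix.det_vandermonde_ne_zero_iff.2 hinj
    have h1 := (finrank_stabilizer_pencil_le (traceForm D) (traceForm G - traceForm D)).filter_mono
      (nhdsNE_le_cofinite 0)
    have h2 := (hWc.matrix_det.continuousAt.eventually_ne hW0).filter_mono
      (nhdsWithin_le_nhds (s := {0}ᶜ))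
    obtain ⟨t, ht1, ht2⟩ := (h1.and h2).exists
    rw [add_sub_cancel, hg, ← hF] at ht1
    refine le_trans ?_ ht1
    have hli : LinearIndependent ℂ fun i : Fin m =>
        (⟨F t ^ (i : ℕ), pow_mem_stabilizer_traceForm (F t) i⟩ : stabilizer (traceForm (F t))) := by
      apply LinearIndependent.of_comp
        (Matrix.diagLinearMap (Fin m) ℂ ℂ ∘ₗ (stabilizer (traceForm (F t))).subtype)
      exact Matrix.linearIndependent_rows_of_det_ne_zero ht2
    simpa using hli.fintype_card_le_finrank

/-! ### Algebras of matrices supported on a preorder. -/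

/-- The algebra of matrices supported on a reflexive and transitive relation. -/
def incidence {n : Type*} [Fintype n] [DecidableEq n] (r : n → n → Prop) (hr : ∀ x, r x x)
    (ht : ∀ x y z, r x y → r y z → r x z) : Subalgebra ℂ (Matrix n n ℂ) where
  carrier := {M | ∀ x y, ¬ r x y → M x y = 0}
  zero_mem' := fun _ _ _ => rfl
  add_mem' := fun hM hN x y h => by rw [Matrix.add_apply, hM x y h, hN x y h, add_zero]
  mul_mem' := fun {M N} hM hN x y h => by
    rw [Matrix.mul_apply]
    refine Finset.sum_eq_zero fun z _ => ?_
    by_cases hz : r x z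
    · rw [hN z y fun h' => h (ht x z y hz h'), mul_zero]
    · rw [hM x z hz, zero_mul]
  one_mem' := fun x y h => Matrix.one_apply_ne fun h' => h (h' ▸ hr x)
  algebraMap_mem' := fun c x y h => by
    rw [Matrix.algebraMap_matrix_apply, if_neg]
    rintro rfl
    exact h (hr x)

section

variable {n : Type*} [Fintype n] [DecidableEq n] {r : n → n → Prop} {hr : ∀ x, r x x}
  {ht : ∀ x y z, r x y → r y z → r x z}

theorem single_mem_incidence {i j : n} (h : r i j) : Matrix.single i j 1 ∈ incidence r hr ht := by
  intro x y hxy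
  rw [Matrix.single_apply, if_neg]
  rintro ⟨rfl, rfl⟩
  exact hxy h

theorem index_incidence_congr {n' : Type*} [Fintype n'] [DecidableEq n'] {r' : n' → n' → Prop}
    {hr' : ∀ x, r' x x} {ht' : ∀ x y z, r' x y → r' y z → r' x z} (e : n ≃ n')
    (h : ∀ x y, r x y ↔ r' (e x) (e y)) :
    index ℂ (incidence r hr ht) = index ℂ (incidence r' hr' ht') := by
  let E : incidence r hr ht ≃ₗ[ℂ] incidence r' hr' ht' :=
    { toFun := fun M => ⟨M.1.submatrix e.symm e.symm, fun x y hxy =>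
        M.2 _ _ fun h' => hxy (by simpa using (h _ _).1 h')⟩
      invFun := fun M => ⟨M.1.submatrix e e, fun x y hxy =>
        M.2 _ _ fun h' => hxy ((h _ _).2 h')⟩
      map_add' := fun _ _ => rfl
      map_smul' := fun _ _ => rfl
      left_inv := fun M => by ext; simp
      right_inv := fun M => by ext; simp }
  refine index_congr E 1 one_ne_zero fun x y => ?_
  apply Subtype.ext
  change (x.1 * y.1 - y.1 * x.1).submatrix e.symm e.symm = (1 : ℂ) •
    (x.1.submatrix e.symm e.symm * y.1.submatrix e.symm e.symm -
      y.1.submatrix e.symm e.symm * x.1.submatrix e.symm e.symm)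
  rw [Matrix.submatrix_mul_equiv, Matrix.submatrix_mul_equiv, one_smul]
  rfl

theorem index_incidence_swap :
    index ℂ (incidence r hr ht) = index ℂ (incidence (fun x y => r y x) hr
      fun x y z hxy hyz => ht z y x hyz hxy) := by
  let E : incidence r hr ht ≃ₗ[ℂ] incidence (fun x y => r y x) hr
      fun x y z hxy hyz => ht z y x hyz hxy :=
    { toFun := fun M => ⟨M.1.transpose, fun x y hxy => M.2 _ _ hxy⟩
      invFun := fun M => ⟨M.1.transpose, fun x y hxy => M.2 _ _ hxy⟩
      map_add' := fun _ _ => rfl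
      map_smul' := fun _ _ => rfl
      left_inv := fun M => rfl
      right_inv := fun M => rfl }
  refine index_congr E (-1) (by simp) fun x y => ?_
  apply Subtype.ext
  change (x.1 * y.1 - y.1 * x.1).transpose = (-1 : ℂ) •
    (x.1.transpose * y.1.transpose - y.1.transpose * x.1.transpose)
  rw [Matrix.transpose_sub, Matrix.transpose_mul, Matrix.transpose_mul]
  module

end

/-- A disjoint block on which the relation is total contributes its size to the index. -/
theorem index_incidence_sum_total {n : Type*} [Fintype n] [DecidableEq n] {m : ℕ}
    {r : n → n → Prop} {hr : ∀ x, r x x} {ht : ∀ x y z, r x y → r y z → r x z}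
    {s : n ⊕ Fin m → n ⊕ Fin m → Prop} {hs : ∀ x, s x x} {hst : ∀ x y z, s x y → s y z → s x z}
    (h11 : ∀ x y, s (.inl x) (.inl y) ↔ r x y) (h12 : ∀ x y, ¬ s (.inl x) (.inr y))
    (h21 : ∀ x y, ¬ s (.inr x) (.inl y)) (h22 : ∀ x y, s (.inr x) (.inr y)) :
    index ℂ (incidence s hs hst) = m + index ℂ (incidence r hr ht) := by
  let e : (incidence r hr ht × Matrix (Fin m) (Fin m) ℂ) ≃ₗ[ℂ] incidence s hs hst :=
    { toFun := fun p => ⟨Matrix.fromBlocks p.1.1 0 0 p.2, by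
        rintro (x | x) (y | y) h
        · exact p.1.2 x y fun h' => h ((h11 x y).2 h')
        · rfl
        · rfl
        · exact absurd (h22 x y) h⟩
      invFun := fun M => (⟨M.1.toBlocks₁₁, fun x y h => M.2 _ _ fun h' => h ((h11 x y).1 h')⟩,
        M.1.toBlocks₂₂)
      map_add' := fun p q => Subtype.ext (by simp [Matrix.fromBlocks_add])
      map_smul' := fun c p => Subtype.ext (by simp [Matrix.fromBlocks_smul])
      left_inv := fun p => rfl
      right_inv := fun M => by
        ext (x | x) (y | y)
        · rfl
        · exact (M.2 _ _ (h12 x y)).symm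
        · exact (M.2 _ _ (h21 x y)).symm
        · rfl }
  rw [← index_congr e 1 one_ne_zero, index_prod, index_matrix, add_comm]
  intro p q
  apply Subtype.ext
  change Matrix.fromBlocks (p.1.1 * q.1.1 - q.1.1 * p.1.1) 0 0 (p.2 * q.2 - q.2 * p.2) = (1 : ℂ) •
    (Matrix.fromBlocks p.1.1 0 0 p.2 * Matrix.fromBlocks q.1.1 0 0 q.2 -
      Matrix.fromBlocks q.1.1 0 0 q.2 * Matrix.fromBlocks p.1.1 0 0 p.2)
  rw [Matrix.fromBlocks_multiply, Matrix.fromBlocks_multiply, one_smul]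
  ext (x | x) (y | y) <;> simp

/-! ### Gluing two copies of a set of indices. -/

section Glue

variable {C O D : Type*}

/-- The relation obtained from a relation on `(C ⊕ O) ⊕ (O ⊕ D)` by identifying the two copies of
`O`. -/
def glue (r : (C ⊕ O) ⊕ (O ⊕ D) → (C ⊕ O) ⊕ (O ⊕ D) → Prop) :
    (C ⊕ O) ⊕ D → (C ⊕ O) ⊕ D → Prop
  | .inl (.inl c), .inl (.inl c') => r (.inl (.inl c)) (.inl (.inl c'))
  | .inl (.inl c), .inl (.inr o) => r (.inl (.inl c)) (.inl (.inr o))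
  -- Whenever (c, second copy of o) is an entry of the corner, fixing the trace form forces the
  -- entry (o, c) to vanish.
  | .inl (.inr o), .inl (.inl c) => r (.inl (.inr o)) (.inl (.inl c)) ∧
      ¬ r (.inl (.inl c)) (.inr (.inl o))
  | .inl (.inr o), .inl (.inr o') => r (.inl (.inr o)) (.inl (.inr o')) ∧
      r (.inr (.inl o)) (.inr (.inl o'))
  | .inl (.inr o), .inr d => r (.inr (.inl o)) (.inr (.inr d))
  | .inr d, .inr d' => r (.inr (.inr d)) (.inr (.inr d'))
  | .inl (.inl _), .inr _ => False
  | .inr _, .inl _ => False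

/-- Conditions under which the two copies of `O` can be identified. -/
structure Gluable (r : (C ⊕ O) ⊕ (O ⊕ D) → (C ⊕ O) ⊕ (O ⊕ D) → Prop) : Prop where
  refl : ∀ x, r x x
  trans : ∀ x y z, r x y → r y z → r x z
  not_snd_fst : ∀ x y, ¬ r (.inr x) (.inl y)
  fst_snd : ∀ o x, r (.inl (.inr o)) (.inr x)
  right_O : ∀ d o, r (.inr (.inr d)) (.inr (.inl o))
  not_C_D : ∀ c d, ¬ r (.inl (.inl c)) (.inr (.inr d))
  -- With `right_O`, `not_C_D` and `O_O`, this supplies an entry of the algebra to move each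
  -- coordinate of the corner, so that the orbit of the trace form is open.
  O_C : ∀ c o, r (.inl (.inl c)) (.inr (.inl o)) → r (.inl (.inr o)) (.inl (.inl c))
  O_O : ∀ o o', r (.inl (.inr o)) (.inl (.inr o')) ∨ r (.inr (.inl o)) (.inr (.inl o'))

variable {r : (C ⊕ O) ⊕ (O ⊕ D) → (C ⊕ O) ⊕ (O ⊕ D) → Prop}

theorem Gluable.glue_refl (h : Gluable r) : ∀ x, glue r x x := by
  rintro ((c | o) | d)
  · exact h.refl _
  · exact ⟨h.refl _, h.refl _⟩
  · exact h.refl _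

theorem Gluable.not_O_C_O (h : Gluable r) {o o' : O} {c : C}
    (h1 : ¬ r (.inl (.inl c)) (.inr (.inl o))) (h2 : r (.inl (.inl c)) (.inl (.inr o'))) : False :=
  h1 (h.trans _ _ _ h2 (h.fst_snd _ _))

theorem Gluable.not_C_O_D (h : Gluable r) {o : O} {c : C} {d : D}
    (h1 : r (.inl (.inl c)) (.inl (.inr o))) : False :=
  h.not_C_D c d (h.trans _ _ _ h1 (h.fst_snd _ _))

theorem Gluable.glue_trans (h : Gluable r) :
    ∀ x y z, glue r x y → glue r y z → glue r x z := by
  rintro ((c | o) | d) ((c' | o') | d') ((c'' | o'') | d'') h1 h2 <;>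
    simp only [glue] at h1 h2 ⊢
  · exact h.trans _ _ _ h1 h2
  · exact h.trans _ _ _ h1 h2
  · exact h.trans _ _ _ h1 h2.1
  · exact h.trans _ _ _ h1 h2.1
  · exact h.not_C_O_D (d := d'') h1
  · exact ⟨h.trans _ _ _ h1.1 h2, fun h3 => h1.2 (h.trans _ _ _ h2 h3)⟩
  · exact (h.not_O_C_O h1.2 h2).elim
  · exact ⟨h.trans _ _ _ h1.1 h2.1, fun h3 => h2.2 (h.trans _ _ _ h3 h1.2)⟩
  · exact ⟨h.trans _ _ _ h1.1 h2.1, h.trans _ _ _ h1.2 h2.2⟩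
  · exact h.trans _ _ _ h1.2 h2
  · exact h.trans _ _ _ h1 h2
  · exact h.trans _ _ _ h1 h2

variable [Fintype C] [Fintype O] [Fintype D] [DecidableEq C] [DecidableEq O] [DecidableEq D]

/-- The second copy of `O`, together with `D`. -/
def sndIncl : O ⊕ D → (C ⊕ O) ⊕ D
  | .inl o => .inl (.inr o)
  | .inr d => .inr d

/-- The embedding of matrices that duplicates the block indexed by `O`. -/
def dup (x : Matrix ((C ⊕ O) ⊕ D) ((C ⊕ O) ⊕ D) ℂ) :
    Matrix ((C ⊕ O) ⊕ (O ⊕ D)) ((C ⊕ O) ⊕ (O ⊕ D)) ℂ :=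
  Matrix.fromBlocks x.toBlocks₁₁ 0 0 (x.submatrix sndIncl sndIncl)

theorem dup_mem (h : Gluable r) {x : Matrix ((C ⊕ O) ⊕ D) ((C ⊕ O) ⊕ D) ℂ}
    (hx : x ∈ incidence (glue r) h.glue_refl h.glue_trans) :
    dup x ∈ incidence r h.refl h.trans := by
  rintro ((c | o) | (o | d)) ((c' | o') | (o' | d')) hr <;>
    simp only [dup, Matrix.fromBlocks_apply₁₁, Matrix.fromBlocks_apply₁₂, Matrix.fromBlocks_apply₂₁,
      Matrix.fromBlocks_apply₂₂, Matrix.zero_apply, Matrix.submatrix_apply, sndIncl,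
      Matrix.toBlocks₁₁, Matrix.of_apply]
  · exact hx _ _ hr
  · exact hx _ _ hr
  · exact hx _ _ fun h' => hr h'.1
  · exact hx _ _ fun h' => hr h'.1
  · exact hx _ _ fun h' => hr h'.2
  · exact hx _ _ hr
  · exact hx _ _ id
  · exact hx _ _ hr

/-- The products lost by restricting to either copy vanish: the glued relation has no chain from O
through C back to O, none from C to D, and none from D to C or O. -/
theorem dup_mul (h : Gluable r) {x y : Matrix ((C ⊕ O) ⊕ D) ((C ⊕ O) ⊕ D) ℂ}
    (hx : x ∈ incidence (glue r) h.glue_refl h.glue_trans)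
    (hy : y ∈ incidence (glue r) h.glue_refl h.glue_trans) :
    dup (x * y) = dup x * dup y := by
  rw [dup, dup, dup, Matrix.fromBlocks_multiply]
  simp only [Matrix.mul_zero, Matrix.zero_mul, add_zero, zero_add]
  congr 1
  · ext p q
    simp only [Matrix.toBlocks₁₁, Matrix.of_apply, Matrix.mul_apply]
    rw [Fintype.sum_sum_type, add_eq_left]
    exact Finset.sum_eq_zero fun d _ => by rw [hy (.inr d) (.inl q) id, mul_zero]
  · ext p q
    simp only [Matrix.submatrix_apply, Matrix.mul_apply, Fintype.sum_sum_type]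
    rw [add_assoc, Finset.sum_eq_zero, zero_add]
    · rfl
    intro c _
    rcases p with o | d
    · rcases q with o' | d'
      · by_cases h1 : glue r (.inl (.inr o)) (.inl (.inl c))
        · have h3 : y (.inl (.inl c)) (sndIncl (.inl o')) = 0 :=
            hy (.inl (.inl c)) (.inl (.inr o')) fun h2 => h.not_O_C_O (o := o) h1.2 h2
          rw [h3, mul_zero]
        · rw [sndIncl, hx _ _ h1, zero_mul]
      · rw [hy (.inl (.inl c)) (sndIncl (.inr d')) id, mul_zero]
    · rw [hx (sndIncl (.inr d)) (.inl (.inl c)) id, zero_mul]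

/-- `dup` as a homomorphism of algebras. -/
def dupHom (h : Gluable r) :
    incidence (glue r) h.glue_refl h.glue_trans →ₐ[ℂ] incidence r h.refl h.trans :=
  AlgHom.ofLinearMap
    { toFun := fun x => ⟨dup x.1, dup_mem h x.2⟩
      map_add' := fun x y => Subtype.ext <| by
        ext (p | p) (q | q) <;> simp [dup, Matrix.toBlocks₁₁]
      map_smul' := fun c x => Subtype.ext <| by
        ext (p | p) (q | q) <;> simp [dup, Matrix.toBlocks₁₁] }
    (Subtype.ext <| by
      ext ((c | o) | (o | d)) ((c' | o') | (o' | d')) <;>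
        simp [dup, Matrix.toBlocks₁₁, Matrix.one_apply, sndIncl])
    fun x y => Subtype.ext (dup_mul h x.2 y.2)

theorem dupHom_val (h : Gluable r) (x : incidence (glue r) h.glue_refl h.glue_trans) :
    (dupHom h x).1 = dup x.1 := rfl

theorem dupHom_injective (h : Gluable r) : Function.Injective (dupHom h) := by
  intro x y hxy
  have hd : dup x.1 = dup y.1 := congrArg Subtype.val hxy
  ext ((c | o) | d) ((c' | o') | d')
  · exact congrFun (congrFun hd (.inl (.inl c))) (.inl (.inl c'))
  · exact congrFun (congrFun hd (.inl (.inl c))) (.inl (.inr o'))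
  · rw [x.2 (.inl (.inl c)) (.inr d') id, y.2 (.inl (.inl c)) (.inr d') id]
  · exact congrFun (congrFun hd (.inl (.inr o))) (.inl (.inl c'))
  · exact congrFun (congrFun hd (.inl (.inr o))) (.inl (.inr o'))
  · exact congrFun (congrFun hd (.inr (.inl o))) (.inr (.inr d'))
  · rw [x.2 (.inr d) (.inl (.inl c')) id, y.2 (.inr d) (.inl (.inl c')) id]
  · rw [x.2 (.inr d) (.inl (.inr o')) id, y.2 (.inr d) (.inl (.inr o')) id]
  · exact congrFun (congrFun hd (.inr (.inr d))) (.inr (.inr d'))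

/-- The ideal of matrices supported on the upper right block. -/
def cornerIdeal (h : Gluable r) : Submodule ℂ (incidence r h.refl h.trans) where
  carrier := {v | (∀ p q, v.1 (.inl p) (.inl q) = 0) ∧ ∀ p q, v.1 (.inr p) (.inr q) = 0}
  zero_mem' := ⟨fun _ _ => rfl, fun _ _ => rfl⟩
  add_mem' := fun {v w} hv hw =>
    ⟨fun p q => by simp [hv.1, hw.1], fun p q => by simp [hv.2, hw.2]⟩
  smul_mem' := fun c v hv => ⟨fun p q => by simp [hv.1], fun p q => by simp [hv.2]⟩

/-- The sum of the diagonal entries of the block with rows in the first and columns in the second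
copy of `O`. -/
def cornerForm (h : Gluable r) : Dual ℂ (incidence r h.refl h.trans) where
  toFun v := ∑ o, v.1 (.inl (.inr o)) (.inr (.inl o))
  map_add' v w := by simp [Finset.sum_add_distrib]
  map_smul' c v := by simp [Finset.mul_sum]

theorem apply_snd_fst (h : Gluable r) (v : incidence r h.refl h.trans) (p : O ⊕ D) (q : C ⊕ O) :
    v.1 (.inr p) (.inl q) = 0 := v.2 _ _ (h.not_snd_fst _ _)

theorem mul_mem_cornerIdeal (h : Gluable r) (x : incidence r h.refl h.trans)
    {v : incidence r h.refl h.trans} (hv : v ∈ cornerIdeal h) :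
    x * v ∈ cornerIdeal h ∧ v * x ∈ cornerIdeal h := by
  refine ⟨⟨fun p q => ?_, fun p q => ?_⟩, ⟨fun p q => ?_, fun p q => ?_⟩⟩ <;>
  simp [Matrix.mul_apply, Fintype.sum_sum_type (α₁ := C ⊕ O), hv.1, hv.2, apply_snd_fst h,
    -Fintype.sum_sum_type]

theorem cornerForm_commutator (h : Gluable r) (a : incidence r h.refl h.trans)
    {v : incidence r h.refl h.trans} (hv : v ∈ cornerIdeal h) :
    cornerForm h (a * v - v * a) =
      (∑ o, ∑ c, a.1 (.inl (.inr o)) (.inl (.inl c)) * v.1 (.inl (.inl c)) (.inr (.inl o))) +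
      (∑ o, ∑ o', (a.1 (.inl (.inr o)) (.inl (.inr o')) - a.1 (.inr (.inl o)) (.inr (.inl o'))) *
        v.1 (.inl (.inr o')) (.inr (.inl o))) -
      ∑ d, ∑ o, a.1 (.inr (.inr d)) (.inr (.inl o)) * v.1 (.inl (.inr o)) (.inr (.inr d)) := by
  have h1 : cornerForm h (a * v - v * a) = ∑ o, ((a.1 * v.1) (.inl (.inr o)) (.inr (.inl o)) -
      (v.1 * a.1) (.inl (.inr o)) (.inr (.inl o))) := rfl
  rw [h1]
  simp only [Matrix.mul_apply, Fintype.sum_sum_type, hv.1, hv.2, zero_mul, mul_zero,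
    Finset.sum_const_zero, add_zero, zero_add, sub_mul, Finset.sum_sub_distrib,
    Finset.sum_add_distrib]
  rw [Finset.sum_comm (s := (Finset.univ : Finset D)),
    Finset.sum_comm (f := fun o o' => a.1 (.inr (.inl o)) (.inr (.inl o')) *
      v.1 (.inl (.inr o')) (.inr (.inl o)))]
  simp only [mul_comm (v.1 _ _)]
  ring

theorem single_mem_cornerIdeal (h : Gluable r) {p : C ⊕ O} {q : O ⊕ D}
    (hpq : r (.inl p) (.inr q)) :
    (⟨Matrix.single (.inl p) (.inr q) 1, single_mem_incidence hpq⟩ : incidence r h.refl h.trans) ∈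
      cornerIdeal h :=
  ⟨fun _ _ => by simp, fun _ _ => by simp⟩

theorem exists_coeff_dual_cornerIdeal (h : Gluable r) (η : Dual ℂ (cornerIdeal h)) :
    ∃ E : C ⊕ O → O ⊕ D → ℂ, ∀ v : cornerIdeal h,
      η v = ∑ p, ∑ q, E p q * v.1.1 (.inl p) (.inr q) := by
  let ι : cornerIdeal h →ₗ[ℂ] Matrix ((C ⊕ O) ⊕ (O ⊕ D)) ((C ⊕ O) ⊕ (O ⊕ D)) ℂ :=
    (incidence r h.refl h.trans).val.toLinearMap ∘ₗ (cornerIdeal h).subtype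
  have hι : ∀ v, ι v = v.1.1 := fun _ => rfl
  have hinj : Function.Injective ι := Subtype.val_injective.comp Subtype.val_injective
  have hker : LinearMap.ker ι = ⊥ := LinearMap.ker_eq_bot_of_injective hinj
  obtain ⟨ψ, hψ⟩ : ∃ ψ : Matrix ((C ⊕ O) ⊕ (O ⊕ D)) ((C ⊕ O) ⊕ (O ⊕ D)) ℂ →ₗ[ℂ] cornerIdeal h,
      ψ ∘ₗ ι = LinearMap.id :=
    LinearMap.exists_leftInverse_of_injective (K := ℂ) (V := cornerIdeal h)
      (V' := Matrix ((C ⊕ O) ⊕ (O ⊕ D)) ((C ⊕ O) ⊕ (O ⊕ D)) ℂ) ι hker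
  refine ⟨fun p q => η (ψ (Matrix.single (.inl p) (.inr q) 1)), fun v => ?_⟩
  have h1 : v.1.1 = ∑ p, ∑ q, v.1.1 (.inl p) (.inr q) •
      Matrix.single (.inl p) (.inr q) (1 : ℂ) := by
    conv_lhs => rw [Matrix.matrix_eq_sum_single v.1.1]
    simp [Fintype.sum_sum_type (α₁ := C ⊕ O), v.2.1, v.2.2, apply_snd_fst h,
      -Fintype.sum_sum_type, Matrix.smul_single]
  have h2 : v = ψ (ι v) := (LinearMap.congr_fun hψ v).symm
  conv_lhs => rw [h2, hι, h1]
  simp only [map_sum, map_smul, smul_eq_mul, mul_comm]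

open Classical in
theorem exists_commutator_cornerForm (h : Gluable r) (η : Dual ℂ (cornerIdeal h)) :
    ∃ x, ∀ v : cornerIdeal h, cornerForm h (x * v - v * x) = η v := by
  obtain ⟨E, hE⟩ := exists_coeff_dual_cornerIdeal h η
  -- A coefficient on O × O can be produced in the first copy or, with opposite sign, in the second.
  -- The first is used when r allows it; otherwise `O_O` allows the second.
  let X₁ : Matrix (C ⊕ O) (C ⊕ O) ℂ := fun p p' => match p with
    | .inl _ => 0
    | .inr o => if r (.inl (.inr o)) (.inl p') then E p' (.inl o) else 0
  let X₂ : Matrix (O ⊕ D) (O ⊕ D) ℂ := fun q q' => match q, q' with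
    | .inl o, .inl o' => if r (.inl (.inr o)) (.inl (.inr o')) then 0 else - E (.inr o') (.inl o)
    | .inr d, .inl o' => - E (.inr o') (.inr d)
    | _, .inr _ => 0
  refine ⟨⟨Matrix.fromBlocks X₁ 0 0 X₂, ?_⟩, fun v => ?_⟩
  · rintro ((c | o) | (o | d)) ((c' | o') | (o' | d')) hr
    · rfl
    · rfl
    · rfl
    · rfl
    · exact if_neg hr
    · exact if_neg hr
    · rfl
    · rfl
    · rfl
    · rfl
    · exact if_pos ((h.O_O o o').resolve_right hr)
    · rfl
    · rfl
    · rfl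
    · exact absurd (h.right_O d o') hr
    · rfl
  · rw [cornerForm_commutator h _ v.2, hE]
    simp only [Matrix.fromBlocks_apply₁₁, Matrix.fromBlocks_apply₂₂, Fintype.sum_sum_type]
    have h1 : ∀ c o, X₁ (.inr o) (.inl c) * v.1.1 (.inl (.inl c)) (.inr (.inl o)) =
        E (.inl c) (.inl o) * v.1.1 (.inl (.inl c)) (.inr (.inl o)) := by
      intro c o
      by_cases hr : r (.inl (.inl c)) (.inr (.inl o))
      · simp only [X₁, if_pos (h.O_C c o hr)]
      · rw [v.1.2 _ _ hr, mul_zero, mul_zero]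
    have h2 : ∀ o o', X₁ (.inr o) (.inr o') - X₂ (.inl o) (.inl o') =
        E (.inr o') (.inl o) := by
      intro o o'
      by_cases hr : r (.inl (.inr o)) (.inl (.inr o')) <;> simp [X₁, X₂, hr]
    have h3 : ∀ c d, v.1.1 (.inl (.inl c)) (.inr (.inr d)) = 0 := fun c d =>
      v.1.2 _ _ (h.not_C_D c d)
    have h4 : ∀ d o, X₂ (.inr d) (.inl o) = - E (.inr o) (.inr d) := fun _ _ => rfl
    simp only [h1, h2, h3, h4, mul_zero, Finset.sum_const_zero, add_zero, neg_mul,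
      Finset.sum_neg_distrib, sub_neg_eq_add, Finset.sum_add_distrib]
    rw [Finset.sum_comm (s := (Finset.univ : Finset D)),
      Finset.sum_comm (s := (Finset.univ : Finset O)) (t := (Finset.univ : Finset C)),
      Finset.sum_comm (f := fun o o' => E (.inr o') (.inl o) *
        v.1.1 (.inl (.inr o')) (.inr (.inl o)))]
    ring

theorem cornerForm_dupHom_commutator (h : Gluable r)
    (x : incidence (glue r) h.glue_refl h.glue_trans) {v : incidence r h.refl h.trans}
    (hv : v ∈ cornerIdeal h) : cornerForm h (dupHom h x * v - v * dupHom h x) = 0 := by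
  rw [cornerForm_commutator h _ hv]
  have h1 : ∀ c o, dup x.1 (.inl (.inr o)) (.inl (.inl c)) *
      v.1 (.inl (.inl c)) (.inr (.inl o)) = 0 := by
    intro c o
    by_cases hr : r (.inl (.inl c)) (.inr (.inl o))
    · have : x.1 (.inl (.inr o)) (.inl (.inl c)) = 0 := x.2 _ _ fun h' => h'.2 hr
      change x.1 (.inl (.inr o)) (.inl (.inl c)) * _ = 0
      rw [this, zero_mul]
    · rw [v.2 _ _ hr, mul_zero]
  have h2 : ∀ o o', dup x.1 (.inl (.inr o)) (.inl (.inr o')) -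
      dup x.1 (.inr (.inl o)) (.inr (.inl o')) = 0 := fun o o' => sub_self _
  have h3 : ∀ d o, dup x.1 (.inr (.inr d)) (.inr (.inl o)) = 0 := fun d o =>
    x.2 (.inr d) (.inl (.inr o)) id
  simp only [dupHom_val, h1, h2, h3, zero_mul, Finset.sum_const_zero, add_zero, sub_zero]

/-- Testing on the matrix units of the corner shows that the two O × O blocks of a agree, that the D
× O block is zero, and that the O × C entries excluded by `glue` are zero. -/
theorem exists_eq_dupHom_add (h : Gluable r) (a : incidence r h.refl h.trans)
    (ha : ∀ v ∈ cornerIdeal h, cornerForm h (a * v - v * a) = 0) :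
    ∃ x, ∃ v ∈ cornerIdeal h, a = dupHom h x + v := by
  have hs : ∀ p q (hpq : r (.inl p) (.inr q)), _ := fun p q hpq =>
    (cornerForm_commutator h a (single_mem_cornerIdeal h hpq)).symm.trans
      (ha _ (single_mem_cornerIdeal h hpq))
  have h1 : ∀ c o, r (.inl (.inl c)) (.inr (.inl o)) →
      a.1 (.inl (.inr o)) (.inl (.inl c)) = 0 := by
    intro c o hr
    simpa [Matrix.single_apply, ite_and] using hs (.inl c) (.inl o) hr
  have h2 : ∀ o o', a.1 (.inl (.inr o)) (.inl (.inr o')) =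
      a.1 (.inr (.inl o)) (.inr (.inl o')) := by
    intro o o'
    have := hs (.inr o') (.inl o) (h.fst_snd _ _)
    rw [← sub_eq_zero]
    simpa [Matrix.single_apply, ite_and] using this
  have h3 : ∀ d o, a.1 (.inr (.inr d)) (.inr (.inl o)) = 0 := by
    intro d o
    simpa [Matrix.single_apply, ite_and] using hs (.inr o) (.inr d) (h.fst_snd _ _)
  let x : Matrix ((C ⊕ O) ⊕ D) ((C ⊕ O) ⊕ D) ℂ := fun p q => match p, q with
    | .inl p, .inl q => a.1 (.inl p) (.inl q)
    | .inl (.inr o), .inr d => a.1 (.inr (.inl o)) (.inr (.inr d))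
    | .inr d, .inr d' => a.1 (.inr (.inr d)) (.inr (.inr d'))
    | .inl (.inl _), .inr _ => 0
    | .inr _, .inl _ => 0
  have hx : x ∈ incidence (glue r) h.glue_refl h.glue_trans := by
    rintro ((c | o) | d) ((c' | o') | d') hr
    · exact a.2 _ _ hr
    · exact a.2 _ _ hr
    · rfl
    · by_cases h' : r (.inl (.inl c')) (.inr (.inl o))
      · exact h1 c' o h'
      · exact a.2 _ _ fun h'' => hr ⟨h'', h'⟩
    · change a.1 (.inl (.inr o)) (.inl (.inr o')) = 0
      by_cases h' : r (.inl (.inr o)) (.inl (.inr o'))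
      · rw [h2]
        exact a.2 _ _ fun h'' => hr ⟨h', h''⟩
      · exact a.2 _ _ h'
    · exact a.2 _ _ hr
    · rfl
    · rfl
    · exact a.2 _ _ hr
  refine ⟨⟨x, hx⟩, a - dupHom h ⟨x, hx⟩, ⟨fun p q => ?_, fun p q => ?_⟩, by abel⟩
  · exact sub_self (a.1 (.inl p) (.inl q))
  · rcases p with o | d <;> rcases q with o' | d'
    · exact sub_eq_zero.2 (h2 o o').symm
    · exact sub_self (a.1 (.inr (.inl o)) (.inr (.inr d')))
    · exact sub_eq_zero.2 (h3 d o')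
    · exact sub_self (a.1 (.inr (.inr d)) (.inr (.inr d')))

/-- Identifying the two copies of `O` does not change the index. -/
theorem index_incidence_glue (h : Gluable r) :
    index ℂ (incidence r h.refl h.trans) =
      index ℂ (incidence (glue r) h.glue_refl h.glue_trans) := by
  refine index_eq_of_ideal (cornerIdeal h) (fun v hv x => (mul_mem_cornerIdeal h x hv).1)
    (fun v hv x => (mul_mem_cornerIdeal h x hv).2) (cornerForm h)
    (exists_commutator_cornerForm h) (dupHom h) (dupHom_injective h) (fun x hx => ?_)
    (fun x v hv => cornerForm_dupHom_commutator h x hv) (exists_eq_dupHom_add h)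
  ext (p | p) (q | q)
  · exact hx.1 p q
  · rfl
  · rfl
  · exact hx.2 p q

end Glue

/-! ### Attaching a total block, and periodicity in its size. -/

section Attach

variable {K R A : Type*}

/-- The relation `q` on `K ⊕ R`, extended by a total block `A` lying above `K` only. -/
def attach (A : Type*) (q : K ⊕ R → K ⊕ R → Prop) : (K ⊕ R) ⊕ A → (K ⊕ R) ⊕ A → Prop
  | .inl x, .inl y => q x y
  | .inl (.inl _), .inr _ => True
  | .inl (.inr _), .inr _ => False
  | .inr _, .inl _ => False
  | .inr _, .inr _ => True

variable {q : K ⊕ R → K ⊕ R → Prop}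

theorem attach_refl (hq : ∀ x, q x x) : ∀ x, attach A q x x := by
  rintro (x | a)
  · exact hq x
  · trivial

theorem attach_trans (hqt : ∀ x y z, q x y → q y z → q x z) (hRK : ∀ r κ, ¬ q (.inr r) (.inl κ)) :
    ∀ x y z, attach A q x y → attach A q y z → attach A q x z := by
  rintro ((κ | r) | a) ((κ' | r') | a') ((κ'' | r'') | a'') h1 h2 <;>
    simp only [attach] at h1 h2 ⊢
  all_goals first
    | exact hqt _ _ _ h1 h2
    | exact hRK _ _ h1

variable [Fintype K] [Fintype R] [Fintype A] [DecidableEq K] [DecidableEq R] [DecidableEq A]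

/-- The index of the algebra given by `attach`. -/
noncomputable def attachIndex (A : Type*) [Fintype A] [DecidableEq A]
    (q : K ⊕ R → K ⊕ R → Prop) (hq : ∀ x, q x x)
    (hqt : ∀ x y z, q x y → q y z → q x z) (hRK : ∀ r κ, ¬ q (.inr r) (.inl κ)) : ℕ :=
  index ℂ (incidence (attach A q) (attach_refl hq) (attach_trans hqt hRK))

theorem attachIndex_congr {A' : Type*} [Fintype A'] [DecidableEq A'] (e : A ≃ A') (hq : ∀ x, q x x)
    (hqt : ∀ x y z, q x y → q y z → q x z) (hRK : ∀ r κ, ¬ q (.inr r) (.inl κ)) :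
    attachIndex A q hq hqt hRK = attachIndex A' q hq hqt hRK := by
  refine index_incidence_congr (Equiv.sumCongr (Equiv.refl _) e) ?_
  rintro ((κ | r) | a) ((κ' | r') | a') <;> exact Iff.rfl

/-- Auxiliary bijection, moving the block `K` of `K ⊕ A` next to the block `A`. -/
def attachEquiv : (R ⊕ K) ⊕ (K ⊕ A) ≃ (K ⊕ R) ⊕ (K ⊕ A) :=
  Equiv.sumCongr (Equiv.sumComm R K) (Equiv.refl _)

/-- Gluing with C = R, O = K, D = A: the base set K is identified with the copy of K inside the
attached block, and the rest A of the block stays attached to K. `O_O` holds because the attached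
block is total. -/
theorem attachIndex_sum (hq : ∀ x, q x x)
    (hqt : ∀ x y z, q x y → q y z → q x z) (hRK : ∀ r κ, ¬ q (.inr r) (.inl κ)) :
    attachIndex (K ⊕ A) q hq hqt hRK = attachIndex A q hq hqt hRK := by
  let r : (R ⊕ K) ⊕ (K ⊕ A) → (R ⊕ K) ⊕ (K ⊕ A) → Prop := fun x y =>
    attach (K ⊕ A) q (attachEquiv x) (attachEquiv y)
  have hr : Gluable r :=
    { refl := fun x => attach_refl hq _
      trans := fun x y z => attach_trans hqt hRK _ _ _
      not_snd_fst := fun x y h => h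
      fst_snd := fun o x => trivial
      right_O := fun d o => trivial
      not_C_D := fun c d h => h
      O_C := fun c o h => h.elim
      O_O := fun o o' => Or.inr trivial }
  rw [attachIndex, ← index_incidence_congr (r := r) (hr := hr.refl) (ht := hr.trans) attachEquiv
    fun x y => Iff.rfl, index_incidence_glue hr, attachIndex]
  refine index_incidence_congr (Equiv.sumCongr (Equiv.sumComm R K) (Equiv.refl _)) ?_
  rintro ((x | κ) | a) ((x' | κ') | a')
  · exact Iff.rfl
  · exact Iff.rfl
  · exact Iff.rfl
  · exact ⟨fun h => h.1, fun h => ⟨h, id⟩⟩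
  · exact ⟨fun h => h.1, fun h => ⟨h, trivial⟩⟩
  · exact Iff.rfl
  · exact Iff.rfl
  · exact Iff.rfl
  · exact Iff.rfl

theorem attachIndex_of_isEmpty [IsEmpty K] (m : ℕ) (hq : ∀ x, q x x)
    (hqt : ∀ x y z, q x y → q y z → q x z) (hRK : ∀ r κ, ¬ q (.inr r) (.inl κ)) :
    attachIndex (Fin m) q hq hqt hRK = m + index ℂ (incidence q hq hqt) := by
  refine index_incidence_sum_total (fun _ _ => Iff.rfl) ?_ (fun _ _ h => h) fun _ _ => trivial
  rintro (κ | r) y h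
  · exact isEmptyElim κ
  · exact h

end Attach

/-! ### Parabolic subalgebras as preorder algebras, and folding across a block. -/

section Parabolic

variable {ι ι' β β' : Type*} [Fintype ι] [DecidableEq ι] [Fintype ι'] [DecidableEq ι']

/-- The index of the algebra of matrices that are block triangular with respect to `b`. -/
noncomputable def blockIndex [Preorder β] (b : ι → β) : ℕ :=
  index ℂ (incidence (fun x y => b x ≤ b y) (fun _ => le_rfl) fun _ _ _ => le_trans)

theorem blockIndex_congr [Preorder β] [Preorder β'] {b : ι → β} {b' : ι' → β'} (e : ι ≃ ι')
    (h : ∀ x y, b x ≤ b y ↔ b' (e x) ≤ b' (e y)) : blockIndex b = blockIndex b' :=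
  index_incidence_congr e h

theorem blockIndex_toDual [Preorder β] (b : ι → β) :
    blockIndex (fun x => OrderDual.toDual (b x)) = blockIndex b :=
  (index_incidence_swap (r := fun x y => b x ≤ b y)).symm

/-- Only the sizes of the blocks matter, so the indices may be relabelled freely. -/
theorem blockIndex_eq_of_card [Preorder β] [DecidableEq β] {b : ι → β} {b' : ι' → β}
    (h : ∀ j, Fintype.card {x // b x = j} = Fintype.card {x // b' x = j}) :
    blockIndex b = blockIndex b' := by
  have e : ∀ j, {x // b x = j} ≃ {x // b' x = j} := fun j => Fintype.equivOfCardEq (h j)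
  refine blockIndex_congr (Equiv.ofFiberEquiv e) fun x y => ?_
  rw [Equiv.ofFiberEquiv_map e, Equiv.ofFiberEquiv_map e]

theorem chi_eq_blockIndex {k : ℕ} (a : Fin k → ℕ) : chi a = blockIndex (block a) := by
  let e : parabolic a ≃ₗ[ℂ] incidence (fun x y => block a x ≤ block a y) (fun _ => le_rfl)
      fun _ _ _ => le_trans :=
    { toFun := fun M => ⟨M.1, fun _ _ h => M.2 (not_le.1 h)⟩
      invFun := fun M => ⟨M.1, fun _ _ h => M.2 _ _ (not_le.2 h)⟩
      map_add' := fun _ _ => rfl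
      map_smul' := fun _ _ => rfl
      left_inv := fun _ => rfl
      right_inv := fun _ => rfl }
  refine index_congr e 1 one_ne_zero fun x y => ?_
  rw [one_smul]
  rfl

theorem card_block_fiber {k : ℕ} (a : Fin k → ℕ) (j : Fin k) :
    Fintype.card {x // block a x = j} = a j := by
  rw [← Fintype.card_fin (a j)]
  refine Fintype.card_congr (Equiv.trans ?_ (Equiv.sigmaSubtype (β := fun j => Fin (a j)) j))
  exact Equiv.subtypeEquiv finSigmaFinEquiv.symm fun x => Iff.rfl

variable {K R A : Type*}

/-- The relation left on `K ⊕ R` when `R` has been identified with a set of blocks on the other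
side. -/
def foldRel [Preorder β] (bL : K ⊕ R → β) (bR : R → β) : K ⊕ R → K ⊕ R → Prop
  | .inl x, y => bL (.inl x) ≤ bL y
  | .inr x, .inr y => bL (.inr x) ≤ bL (.inr y) ∧ bR x ≤ bR y
  | .inr _, .inl _ => False

theorem foldRel_refl [Preorder β] (bL : K ⊕ R → β) (bR : R → β) : ∀ x, foldRel bL bR x x := by
  rintro (x | x)
  · exact le_refl _
  · exact ⟨le_rfl, le_rfl⟩

theorem not_foldRel_inr_inl [Preorder β] (bL : K ⊕ R → β) (bR : R → β) (x : R) (y : K) :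
    ¬ foldRel bL bR (.inr x) (.inl y) := id

theorem foldRel_trans [Preorder β] (bL : K ⊕ R → β) (bR : R → β) :
    ∀ x y z, foldRel bL bR x y → foldRel bL bR y z → foldRel bL bR x z := by
  rintro (x | x) (y | y) (z | z) h1 h2
  · exact le_trans (b := bL (.inl y)) h1 h2
  · exact le_trans (b := bL (.inl y)) h1 h2
  · exact h2.elim
  · exact le_trans (b := bL (.inr y)) h1 h2.1
  · exact h1.elim
  · exact h1.elim
  · exact h2.elim
  · exact ⟨h1.1.trans h2.1, h1.2.trans h2.2⟩

variable [Fintype K] [Fintype R] [Fintype A] [DecidableEq K] [DecidableEq R] [DecidableEq A]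

/-- Gluing with C = K ⊕ A, O = R and D empty. Every index of K and A lies below all of the second
copy of R, so all entries from R to K or A disappear and A remains related to K alone. -/
theorem blockIndex_eq_attachIndex [Preorder β] (i : β) (bL : K ⊕ R → β) (bR : R → β)
    (hL : ∀ x, bL x < i) (hR : ∀ x, i < bR x) (hK : ∀ r κ, bL (.inr r) ≤ bL (.inl κ))
    (hO : ∀ r r', bL (.inr r) ≤ bL (.inr r') ∨ bR r ≤ bR r') :
    blockIndex (Sum.elim (Sum.elim bL fun _ : A => i) bR) =
      attachIndex A (foldRel bL bR) (foldRel_refl bL bR) (foldRel_trans bL bR)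
        (not_foldRel_inr_inl bL bR) := by
  let b : ((K ⊕ A) ⊕ R) ⊕ (R ⊕ Empty) → β :=
    Sum.elim (Sum.elim (Sum.elim (fun x => bL (.inl x)) fun _ => i) fun x => bL (.inr x))
      (Sum.elim bR Empty.elim)
  have hr : Gluable fun x y => b x ≤ b y :=
    { refl := fun x => le_rfl
      trans := fun x y z => le_trans
      not_snd_fst := by
        rintro (x | x) ((y | y) | y)
        · exact not_le_of_gt ((hL _).trans (hR _))
        · exact not_le_of_gt (hR _)
        · exact not_le_of_gt ((hL _).trans (hR _))
        all_goals exact x.elim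
      fst_snd := by
        rintro o (x | x)
        · exact ((hL _).trans (hR _)).le
        · exact x.elim
      right_O := fun d => d.elim
      not_C_D := fun _ d => d.elim
      O_C := by
        rintro (c | c) o -
        · exact hK _ _
        · exact (hL _).le
      O_O := hO }
  let e : (K ⊕ A) ⊕ R ≃ (K ⊕ R) ⊕ A :=
    { toFun := Sum.elim (Sum.elim (fun x => .inl (.inl x)) .inr) fun x => .inl (.inr x)
      invFun := Sum.elim (Sum.elim (fun x => .inl (.inl x)) .inr) fun x => .inl (.inr x)
      left_inv := by rintro ((x | x) | x) <;> rfl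
      right_inv := by rintro ((x | x) | x) <;> rfl }
  have h1 : blockIndex (Sum.elim (Sum.elim bL fun _ : A => i) bR) = blockIndex b := by
    refine (blockIndex_congr (Equiv.sumCongr e (Equiv.sumEmpty R Empty)) ?_).symm
    rintro (((x | x) | x) | (x | x)) (((y | y) | y) | (y | y))
    all_goals first
      | exact Iff.rfl
      | exact x.elim
      | exact y.elim
  rw [h1, blockIndex, index_incidence_glue hr]
  unfold attachIndex
  refine index_incidence_congr ((Equiv.sumEmpty _ Empty).trans e) ?_
  rintro (((x | x) | x) | x) (((y | y) | y) | y)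
  all_goals first
    | exact x.elim
    | exact y.elim
    | skip
  · exact Iff.rfl
  · exact iff_of_true (hL _).le trivial
  · exact Iff.rfl
  · exact iff_of_false (not_le_of_gt (hL _)) id
  · exact iff_of_true le_rfl trivial
  · exact iff_of_false (not_le_of_gt (hL _)) id
  · exact iff_of_false (fun h => h.2 ((hL _).trans (hR _)).le) id
  · exact iff_of_false (fun h => h.2 (hR _).le) id
  · exact Iff.rfl

end Parabolic

/-! ### Choosing the fold from the block sizes. -/

section Reduction

theorem card_sumElim_fiber {X Y β : Type*} [Fintype X] [Fintype Y] [DecidableEq β] (f : X → β)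
    (g : Y → β) (j : β) : Fintype.card {x // Sum.elim f g x = j} =
      Fintype.card {x // f x = j} + Fintype.card {y // g y = j} := by
  rw [Fintype.card_congr Equiv.subtypeSum, Fintype.card_sum]
  rfl

theorem card_fiber_comp {X Y β : Type*} [Fintype X] [Fintype Y] [DecidableEq β] (e : X ≃ Y)
    (f : Y → β) (j : β) : Fintype.card {x // f (e x) = j} = Fintype.card {y // f y = j} :=
  Fintype.card_congr (Equiv.subtypeEquiv e fun _ => Iff.rfl)

theorem card_fiber_eq_zero {X β : Type*} [Fintype X] [DecidableEq β] (f : X → β) (j : β)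
    (h : ∀ x, f x ≠ j) : Fintype.card {x // f x = j} = 0 := by
  rw [Fintype.card_eq_zero_iff]
  exact ⟨fun x => h x.1 x.2⟩

variable {β : Type*} [LinearOrder β]

theorem exists_monotone_card_fiber (s : Finset β) (w : β → ℕ) :
    ∃ c : Fin (∑ j ∈ s, w j) → β, Monotone c ∧ (∀ x, c x ∈ s) ∧
      ∀ j ∈ s, Fintype.card {x // c x = j} = w j := by
  have hcard : Fintype.card (Σ j : s, Fin (w j)) = Fintype.card (Fin (∑ j ∈ s, w j)) := by
    rw [Fintype.card_sigma, Fintype.card_fin]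
    simp only [Fintype.card_fin]
    exact Finset.sum_coe_sort s w
  let e := Fintype.equivOfCardEq hcard
  let c₀ : Fin (∑ j ∈ s, w j) → β := fun x => (e.symm x).1
  refine ⟨c₀ ∘ Tuple.sort c₀, Tuple.monotone_sort c₀, fun x => (e.symm _).1.2, fun j hj => ?_⟩
  rw [← Fintype.card_fin (w j)]
  simp only [Function.comp_apply, c₀]
  rw [card_fiber_comp (Tuple.sort c₀) fun x => ((e.symm x).1 : β),
    card_fiber_comp e.symm fun x : (Σ j : s, Fin (w j)) => (x.1 : β)]
  refine Fintype.card_congr (Equiv.trans (Equiv.subtypeEquiv (Equiv.refl _) fun x => ?_)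
    (Equiv.sigmaSubtype (β := fun j : s => Fin (w j)) ⟨j, hj⟩))
  exact (Subtype.ext_iff (a1 := x.1) (a2 := ⟨j, hj⟩)).symm

variable [LocallyFiniteOrderBot β] [LocallyFiniteOrderTop β]

theorem exists_fold (i : β) (w : β → ℕ) {l r : ℕ} (hl : ∑ j ∈ Finset.Iio i, w j = r + l)
    (hr : ∑ j ∈ Finset.Ioi i, w j = r) :
    ∃ (bL : Fin l ⊕ Fin r → β) (bR : Fin r → β), (∀ x, bL x < i) ∧ (∀ x, i < bR x) ∧
      (∀ x y, bL (.inr x) ≤ bL (.inl y)) ∧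
      (∀ x y, bL (.inr x) ≤ bL (.inr y) ∨ bR x ≤ bR y) ∧
      (∀ j < i, Fintype.card {x // bL x = j} = w j) ∧
      ∀ j, i < j → Fintype.card {x // bR x = j} = w j := by
  obtain ⟨c, hc, hcs, hcw⟩ := exists_monotone_card_fiber (Finset.Iio i) w
  obtain ⟨c', hc', hcs', hcw'⟩ := exists_monotone_card_fiber (Finset.Ioi i) w
  -- The r folded indices come first among those before `i`, so they lie in blocks no later than
  -- those of the l remaining ones.
  let e : Fin l ⊕ Fin r ≃ Fin (∑ j ∈ Finset.Iio i, w j) :=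
    (Equiv.sumComm _ _).trans (finSumFinEquiv.trans (finCongr hl.symm))
  -- The order is reversed on the other side, so any two folded indices are comparable in the
  -- required direction in at least one copy; this is `O_O`.
  let e' : Fin r ≃ Fin (∑ j ∈ Finset.Ioi i, w j) := Fin.revPerm.trans (finCongr hr.symm)
  have he₁ : ∀ x, (e (.inr x) : ℕ) = x := fun x => by simp [e]
  have he₂ : ∀ y, (e (.inl y) : ℕ) = r + y := fun y => by simp [e]
  have he' : ∀ x, (e' x : ℕ) = r - (x + 1) := fun x => by simp [e']
  refine ⟨fun x => c (e x), fun x => c' (e' x), fun x => Finset.mem_Iio.1 (hcs _),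
    fun x => Finset.mem_Ioi.1 (hcs' _), fun x y => hc ?_, fun x y => ?_, fun j hj => ?_,
    fun j hj => ?_⟩
  · rw [Fin.le_def, he₁, he₂]
    omega
  · rcases le_total x y with h | h
    · refine Or.inl (hc ?_)
      rwa [Fin.le_def, he₁, he₁]
    · refine Or.inr (hc' ?_)
      rw [Fin.le_def] at h ⊢
      rw [he', he']
      omega
  · rw [card_fiber_comp e]
    exact hcw j (Finset.mem_Iio.2 hj)
  · rw [card_fiber_comp e']
    exact hcw' j (Finset.mem_Ioi.2 hj)

/-- The reduction, in the case where the blocks before `i` are at least as large as those after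
it: `g m` is the index when the block `i` has size `m`. -/
theorem exists_blockIndex_reduction (i : β) (w : β → ℕ) {l r : ℕ}
    (hl : ∑ j ∈ Finset.Iio i, w j = r + l) (hr : ∑ j ∈ Finset.Ioi i, w j = r) :
    ∃ g : ℕ → ℕ,
      (∀ (m n : ℕ) (b : Fin n → β),
        (∀ j, Fintype.card {x // b x = j} = Function.update w i m j) → blockIndex b = g m) ∧
      (∀ m, g (l + m) = g m) ∧ (l = 0 → ∀ m, g m = m + g 0) := by
  obtain ⟨bL, bR, hL, hR, hK, hO, hLw, hRw⟩ := exists_fold i w hl hr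
  refine ⟨fun m => attachIndex (Fin m) (foldRel bL bR) (foldRel_refl bL bR) (foldRel_trans bL bR)
    (not_foldRel_inr_inl bL bR), fun m n b hb => ?_, fun m => ?_, fun h0 m => ?_⟩
  · refine Eq.trans (blockIndex_eq_of_card fun j => ?_)
      (blockIndex_eq_attachIndex i bL bR hL hR hK hO)
    rw [hb, card_sumElim_fiber, card_sumElim_fiber]
    rcases lt_trichotomy j i with hj | rfl | hj
    · rw [Function.update_of_ne hj.ne, hLw j hj, card_fiber_eq_zero _ j fun x => hj.ne',
        card_fiber_eq_zero _ j fun x => (hj.trans (hR x)).ne', add_zero, add_zero]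
    · rw [Function.update_self, card_fiber_eq_zero _ j fun x => (hL x).ne,
        card_fiber_eq_zero _ j fun x => (hR x).ne']
      simp
    · rw [Function.update_of_ne hj.ne', hRw j hj, card_fiber_eq_zero _ j fun x => hj.ne,
        card_fiber_eq_zero _ j fun x => ((hL x).trans hj).ne]
      simp
  · exact (attachIndex_congr finSumFinEquiv.symm _ _ _).trans (attachIndex_sum _ _ _)
  · subst h0
    beta_reduce
    rw [attachIndex_of_isEmpty, attachIndex_of_isEmpty, zero_add]

end Reduction

/-- The index as a function of the size `m` of the block `i`. -/
theorem exists_chi_reduction {k : ℕ} (a : Fin (k + 1) → ℕ) (i : Fin (k + 1)) :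
    ∃ g : ℕ → ℕ, (∀ m, chi (Function.update a i m) = g m) ∧ chi (i.removeNth a) = g 0 ∧
      (∀ m, g ((d a i).natAbs + m) = g m) ∧ ((d a i).natAbs = 0 → ∀ m, g m = m + g 0) := by
  have hrem : ∀ j, Fintype.card {x // i.succAbove (block (i.removeNth a) x) = j} =
      Function.update a i 0 j := by
    intro j
    rcases Fin.eq_self_or_eq_succAbove i j with rfl | ⟨j, rfl⟩
    · rw [Function.update_self]
      exact card_fiber_eq_zero _ _ fun x => Fin.succAbove_ne _ _
    · rw [Function.update_of_ne (Fin.succAbove_ne i j)]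
      simp only [Fin.succAbove_right_inj]
      exact card_block_fiber _ j
  have hrem' : chi (i.removeNth a) =
      blockIndex fun x => i.succAbove (block (i.removeNth a) x) := by
    rw [chi_eq_blockIndex]
    exact blockIndex_congr (Equiv.refl _) fun x y => Fin.succAbove_le_succAbove_iff.symm
  -- For the last block the sign in the definition of `d` is the opposite one, but the absolute
  -- value follows the common formula since nothing comes after.
  have hd : (d a i).natAbs =
      ((∑ j ∈ Finset.Iio i, a j : ℕ) - (∑ j ∈ Finset.Ioi i, a j : ℕ) : ℤ).natAbs := by
    rw [d]
    split_ifs with h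
    · subst h
      have : Finset.Ioi (Fin.last k) = ∅ := by
        ext j
        simp [Fin.le_last]
      rw [this]
      simp
    · simp
  rcases le_total (∑ j ∈ Finset.Ioi i, a j) (∑ j ∈ Finset.Iio i, a j) with h | h
  · obtain ⟨l, hl⟩ := Nat.exists_eq_add_of_le h
    have hdl : (d a i).natAbs = l := by rw [hd, hl]; simp
    rw [hdl]
    obtain ⟨g, hg, hg'⟩ := exists_blockIndex_reduction i a hl rfl
    refine ⟨g, fun m => ?_, ?_, hg'⟩
    · rw [chi_eq_blockIndex]
      exact hg m _ _ fun j => card_block_fiber _ j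
    · rw [hrem']
      exact hg 0 _ _ hrem
  · obtain ⟨l, hl⟩ := Nat.exists_eq_add_of_le h
    have hdl : (d a i).natAbs = l := by rw [hd, hl]; simp
    rw [hdl]
    -- The blocks after `i` are now the larger side; transposition reverses the order of the blocks.
    have h1 : ∑ j ∈ Finset.Iio (OrderDual.toDual i), a (OrderDual.ofDual j) =
        ∑ j ∈ Finset.Ioi i, a j := by
      rw [Finset.Iio_toDual, Finset.sum_map]
      rfl
    have h2 : ∑ j ∈ Finset.Ioi (OrderDual.toDual i), a (OrderDual.ofDual j) =
        ∑ j ∈ Finset.Iio i, a j := by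
      rw [Finset.Ioi_toDual, Finset.sum_map]
      rfl
    obtain ⟨g, hg, hg'⟩ := exists_blockIndex_reduction (OrderDual.toDual i)
      (fun j => a (OrderDual.ofDual j)) (h1.trans hl) h2
    refine ⟨g, fun m => ?_, ?_, hg'⟩
    · rw [chi_eq_blockIndex, ← blockIndex_toDual]
      exact hg m _ _ fun j => card_block_fiber _ (OrderDual.ofDual j)
    · rw [hrem', ← blockIndex_toDual]
      exact hg 0 _ _ fun j => hrem (OrderDual.ofDual j)

end GlIndex

theorem mainTheorem2 (k : ℕ) (a : Fin (k + 1) → ℕ) (i : Fin (k + 1)) :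
    (GlIndex.d a i ≠ 0 →
      (∀ (α : ℤ) (b : ℕ), (b : ℤ) = (a i : ℤ) + α * |GlIndex.d a i| →
        GlIndex.chi a = GlIndex.chi (Function.update a i b)) ∧
      GlIndex.chi a = GlIndex.chi (Function.update a i (a i % (GlIndex.d a i).natAbs))) ∧
    (GlIndex.d a i = 0 →
      GlIndex.chi a = a i + GlIndex.chi (i.removeNth a)) := by
  obtain ⟨g, hg, hg0, hper, hzero⟩ := GlIndex.exists_chi_reduction a i
  have ha : GlIndex.chi a = g (a i) := by
    conv_lhs => rw [← Function.update_eq_self i a]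
    exact hg (a i)
  have hper' : Function.Periodic g (GlIndex.d a i).natAbs := fun m => by rw [add_comm, hper]
  refine ⟨fun _ => ⟨fun α b hb => ?_, ?_⟩, fun h0 => ?_⟩
  -- As α may be negative while g is defined on ℕ, both sizes are compared through their common
  -- remainder.
  · rw [ha, hg, ← hper'.map_mod_nat b, ← hper'.map_mod_nat (a i)]
    congr 1
    zify
    rw [hb, Int.add_mul_emod_self_right]
  · rw [ha, hg, hper'.map_mod_nat]
  · rw [ha, hg0]
    exact hzero (by rw [h0]; rfl) _
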